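/- Let $N\ge 2$ and $0<s<t\le 1$. For a measurable set $E\subset\mathbb R^N$ and $\alpha\in(0,1)$ let $$P_\alpha(E)=\int_E\int_{E^c}\frac{dx\,dy}{|x-y|^{N+\alpha}}$$ be the fractional perimeter, let $P(E)=\sup\{\int_E \operatorname{div}T : T\in C^1_c(\mathbb R^N;\mathbb R^N),\ |T|\le 1\}$ be the classical perimeter, let $\omega_N$ be the volume of the unit ball, and set $$\mathcal F_{s,t}(E)=\begin{cases}(1-t)P_t(E)-sP_s(E) & \text{if } t<1,\\ N\omega_N P(E)-sP_s(E) & \text{if } t=1,\end{cases}$$ with $\mathcal F_{s,t}(E)=+\infty$ if the first term is infinite. For $m>0$ consider the problem of minimizing $\mathcal F_{s,t}(E)$ among the measurable sets with $|E|=m$, and let $B_m$ be a ball of volume $m$. There is a volume $\bar m_2=\bar m_2(N,s,t)>0$ such that, for every $m>\bar m_2$, the ball $B_m$ is not a local minimizer of this problem: for every $\delta>0$ there is a measurable set $E$ with $|E|=m$, $|E\,\Delta\,B_m|<\delta$ and $\mathcal F_{s,t}(E)<\mathcal F_{s,t}(B_m)$. The ball is not a local minimizer in the $C^1$ sense either: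 writing $B_m=B(x_0,R)$, for every $\delta>0$ there is such a set $E$ of volume $m$ and energy below that of $B_m$ with $\partial E=\{x_0+R(1+u(x))x : |x|=1\}$ for some $u\in C^1(\partial B(0,1))$ with $\|u\|_{C^1}\le\delta$. Moreover $\bar m_2\ge\bar m_1$ for every $\bar m_1$ with the property that, for all $m\in(0,\bar m_1)$, the minimizers of the problem are exactly the balls of volume $m$ (up to null sets). -/

import Mathlib

open MeasureTheory Metric Set
open scoped ENNReal

noncomputable section

/-- Divergence of a vector field on `ℝ^N`. -/
def divergence {N : ℕ} (T : EuclideanSpace ℝ (Fin N) → EuclideanSpace ℝ (Fin N))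
    (x : EuclideanSpace ℝ (Fin N)) : ℝ :=
  ∑ i : Fin N, fderiv ℝ T x (EuclideanSpace.single i 1) i

/-- The classical (De Giorgi) perimeter
`P(E) = sup { ∫_E div T : T ∈ C¹_c(ℝ^N; ℝ^N), |T| ≤ 1 }`. -/
def perimeter {N : ℕ} (E : Set (EuclideanSpace ℝ (Fin N))) : ℝ≥0∞ :=
  ⨆ (T : EuclideanSpace ℝ (Fin N) → EuclideanSpace ℝ (Fin N)) (_ : ContDiff ℝ 1 T)
    (_ : HasCompactSupport T) (_ : ∀ x, ‖T x‖ ≤ 1),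
    ENNReal.ofReal (∫ x in E, divergence T x)

/-- The fractional perimeter `P_α(E) = ∫_E ∫_{Eᶜ} dx dy / |x - y|^{N+α}`. -/
def fracPerimeter {N : ℕ} (α : ℝ) (E : Set (EuclideanSpace ℝ (Fin N))) : ℝ≥0∞ :=
  ∫⁻ x in E, ∫⁻ y in Eᶜ, ENNReal.ofReal (1 / ‖x - y‖ ^ ((N : ℝ) + α))

/-- `N ω_N`, where `ω_N` is the volume of the unit ball of `ℝ^N`. -/
def dimOmega (N : ℕ) : ℝ≥0∞ :=
  (N : ℝ≥0∞) * volume (ball (0 : EuclideanSpace ℝ (Fin N)) 1)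

/-- The attractive part of the energy: `(1 - t) P_t(E)` if `t < 1` and `N ω_N P(E)` if `t = 1`. -/
def attractivePart {N : ℕ} (t : ℝ) (E : Set (EuclideanSpace ℝ (Fin N))) : ℝ≥0∞ :=
  if t = 1 then dimOmega N * perimeter E else ENNReal.ofReal (1 - t) * fracPerimeter t E

/-- The repulsive part of the energy: `s P_s(E)` if `0 < s` and `N ω_N |E|` if `s = 0`. -/
def repulsivePart {N : ℕ} (s : ℝ) (E : Set (EuclideanSpace ℝ (Fin N))) : ℝ≥0∞ :=
  if s = 0 then dimOmega N * volume E else ENNReal.ofReal s * fracPerimeter s E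

/-- The energy `F_{s,t}`, the attractive part minus the repulsive part.  A set whose attractive
part is infinite has energy `+∞` (this also settles the case `∞ - ∞`). -/
def energy {N : ℕ} (s t : ℝ) (E : Set (EuclideanSpace ℝ (Fin N))) : EReal :=
  if attractivePart t E = ⊤ then ⊤
  else ((attractivePart t E : ℝ≥0∞) : EReal) - ((repulsivePart s E : ℝ≥0∞) : EReal)

/-- The competitors of the problem with volume `m`: the Lebesgue measurable sets `E` with
`|E| = m`. -/
def Admissible {N : ℕ} (m : ℝ) (E : Set (EuclideanSpace ℝ (Fin N))) : Prop :=
  NullMeasurableSet E volume ∧ volume E = ENNReal.ofReal m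

/-- `E` is a (global) minimizer of `F_{s,t}` among the sets of volume `m`. -/
def IsVolMinimizer {N : ℕ} (s t m : ℝ) (E : Set (EuclideanSpace ℝ (Fin N))) : Prop :=
  Admissible m E ∧
    ∀ E' : Set (EuclideanSpace ℝ (Fin N)), Admissible m E' → energy s t E ≤ energy s t E'

/-- `E` is a local minimizer (in `L¹`) of `F_{s,t}` among the sets of volume `m`: it has least
energy among the sets `E'` of volume `m` for which `|E Δ E'|` is small. -/
def IsVolLocalMinimizer {N : ℕ} (s t m : ℝ) (E : Set (EuclideanSpace ℝ (Fin N))) : Prop :=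
  Admissible m E ∧ ∃ δ : ℝ, 0 < δ ∧
    ∀ E' : Set (EuclideanSpace ℝ (Fin N)), Admissible m E' →
      volume (symmDiff E E') < ENNReal.ofReal δ → energy s t E ≤ energy s t E'

/-- The radius of a ball of volume `m` in `ℝ^N`. -/
def ballRadius (N : ℕ) (m : ℝ) : ℝ :=
  (m / (volume (ball (0 : EuclideanSpace ℝ (Fin N)) 1)).toReal) ^ (1 / (N : ℝ))

/-- The ball of volume `m` with centre `x₀`. -/
def ballOfVolume {N : ℕ} (x₀ : EuclideanSpace ℝ (Fin N)) (m : ℝ) :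
    Set (EuclideanSpace ℝ (Fin N)) :=
  ball x₀ (ballRadius N m)

/-- The ball of volume `m` is indeed a competitor of volume `m`. -/
theorem admissible_ballOfVolume {N : ℕ} (hN : N ≠ 0) {m : ℝ} (hm : 0 < m)
    (x₀ : EuclideanSpace ℝ (Fin N)) : Admissible m (ballOfVolume x₀ m) := by
  have hNt : Nonempty (Fin N) := ⟨⟨0, Nat.pos_of_ne_zero hN⟩⟩
  refine ⟨measurableSet_ball.nullMeasurableSet, ?_⟩
  have hfin : volume (ball (0 : EuclideanSpace ℝ (Fin N)) 1) ≠ ⊤ := measure_ball_lt_top.ne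
  have hpos : 0 < (volume (ball (0 : EuclideanSpace ℝ (Fin N)) 1)).toReal :=
    ENNReal.toReal_pos (measure_ball_pos volume _ one_pos).ne' hfin
  have hq : 0 ≤ m / (volume (ball (0 : EuclideanSpace ℝ (Fin N)) 1)).toReal := by positivity
  have hR : ballRadius N m ^ N = m / (volume (ball (0 : EuclideanSpace ℝ (Fin N)) 1)).toReal := by
    rw [ballRadius, one_div, Real.rpow_inv_natCast_pow hq hN]
  have hR0 : 0 ≤ ballRadius N m := Real.rpow_nonneg hq _
  rw [ballOfVolume, Measure.addHaar_ball volume x₀ hR0, finrank_euclideanSpace_fin, hR]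
  nth_rewrite 2 [← ENNReal.ofReal_toReal hfin]
  rw [← ENNReal.ofReal_mul hq, div_mul_cancel₀ _ hpos.ne']

/-- `u`, as a function on the unit sphere, is of class `C¹` with `C¹`-norm at most `δ`.  Only the
values of `u` on the sphere matter: the derivative of its `0`-homogeneous extension
`x ↦ u (x / |x|)` at a point of the sphere is the tangential derivative of `u`. -/
def SphereC1Le {N : ℕ} (u : EuclideanSpace ℝ (Fin N) → ℝ) (δ : ℝ) : Prop :=
  ContDiffOn ℝ 1 (fun x => u (‖x‖⁻¹ • x)) {0}ᶜ ∧
    ∀ x ∈ sphere (0 : EuclideanSpace ℝ (Fin N)) 1,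
      |u x| ≤ δ ∧ ‖fderiv ℝ (fun y => u (‖y‖⁻¹ • y)) x‖ ≤ δ

/-- The ball of volume `m` centred at `x₀` is a local minimizer in the weaker, `C¹`, sense: it has
least energy among the sets of volume `m` whose boundary is the graph
`{x₀ + R (1 + u(x)) x : |x| = 1}` over its own boundary of a function `u` of small `C¹`-norm. -/
def BallIsC1LocalMinimizer {N : ℕ} (s t m : ℝ) (x₀ : EuclideanSpace ℝ (Fin N)) : Prop :=
  ∃ δ : ℝ, 0 < δ ∧
    ∀ (u : EuclideanSpace ℝ (Fin N) → ℝ) (E' : Set (EuclideanSpace ℝ (Fin N))),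
      SphereC1Le u δ → Admissible m E' →
      frontier E' = (fun x => x₀ + (ballRadius N m * (1 + u x)) • x) '' sphere 0 1 →
      energy s t (ballOfVolume x₀ m) ≤ energy s t E'

/-- For every volume in `(0, m₁)` the minimizers are exactly the balls (up to null sets). -/
def BallsOnlyMinimizersBelow (N : ℕ) (s t m₁ : ℝ) : Prop :=
  ∀ m : ℝ, 0 < m → m < m₁ → ∀ E : Set (EuclideanSpace ℝ (Fin N)),
    IsVolMinimizer s t m E ↔
      ∃ x₀ : EuclideanSpace ℝ (Fin N), E =ᵐ[volume] ballOfVolume x₀ m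

end

/-! The ball is compared with ellipsoids `x₀ + R D(B)`, where `B` is the unit ball and `D` is
linear, volume preserving and close to the identity. The key is that the perimeters involved are
governed by the averages J(p) = ∫ |Dω|^{-(N+p)} dσ(ω) over the unit sphere.

The fractional perimeter of the ellipsoid is exactly κ R^{N-α} J(α): after the change of variables
the kernel |Dz|^{-(N+α)} is integrated against a radial weight, so that polar coordinates split off
a constant κ free of `D` (`exists_fracPerimeter_ellipsoid`). For the classical perimeter an upper
bound R^{N-1} J(1) for the ellipsoid and the lower bound R^{N-1} σ(S) for the ball are enough
(`perimeter_ellipsoid_le`, `le_perimeter_ball`).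

Put h = |Dω|^{-N}. Preservation of volume gives h the mean 1, and J(p) is the integral of h^{1+p/N}.
Bernoulli's inequality gives J(s) > σ(S) unless |Dω| = 1 everywhere. Jensen's inequality for K
h^{1+s/N} - h^{1+t/N}, convex on [1/2, 2] for large K, gives J(t) - σ(S) ≤ K (J(s) - σ(S)) with K
independent of `D` (`exists_integral_one_div_norm_rpow_sub_le`).

Hence the energy of the ellipsoid minus that of the ball is at most (A K R^{N-t} - B R^{N-s}) (J(s)
- σ(S)). This is negative as soon as R^{t-s} > A K / B, a threshold that does not depend on `D`.
Letting `D` tend to the identity yields competitors that are arbitrarily close in L¹ and in C¹. A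
volume above the threshold cannot have the ball as global minimizer either, whence the comparison
with every m₁. -/

noncomputable section

/-! ### Polar coordinates. -/

section Polar

variable {E : Type*} [NormedAddCommGroup E] [NormedSpace ℝ E] [FiniteDimensional ℝ E]
  [MeasurableSpace E] [BorelSpace E]

/-- Integration in polar coordinates. -/
theorem lintegral_eq_lintegral_toSphere [Nontrivial E] (μ : Measure E) [μ.IsAddHaarMeasure]
    {f : E → ℝ≥0∞} (hf : Measurable f) :
    ∫⁻ x, f x ∂μ = ∫⁻ ω, ∫⁻ r in Ioi (0 : ℝ),
      ENNReal.ofReal (r ^ (Module.finrank ℝ E - 1)) * f (r • (ω : E)) ∂volume ∂μ.toSphere := by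
  have h := μ.measurePreserving_homeomorphUnitSphereProd.symm
    (e := (homeomorphUnitSphereProd E).toMeasurableEquiv)
  have h1 : ∫⁻ x, f x ∂μ = ∫⁻ x : ({0}ᶜ : Set E), f x ∂(μ.comap (↑)) := by
    rw [lintegral_subtype_comap (measurableSet_singleton _).compl, restrict_compl_singleton]
  rw [h1]
  change ∫⁻ x, (f ∘ Subtype.val) x ∂_ = _
  rw [← h.lintegral_comp (hf.comp measurable_subtype_coe), lintegral_prod]
  · refine lintegral_congr fun ω => ?_
    rw [Measure.volumeIoiPow, lintegral_withDensity_eq_lintegral_mul]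
    · rw [← lintegral_subtype_comap measurableSet_Ioi]
      rfl
    · fun_prop
    · exact hf.comp (measurable_subtype_coe.comp
        ((homeomorphUnitSphereProd E).symm.measurable.comp (by fun_prop)))
  · exact ((hf.comp measurable_subtype_coe).comp
      (homeomorphUnitSphereProd E).symm.measurable).aemeasurable

end Polar

/-! ### The radial weight behind the fractional perimeter of ellipsoids. -/

section BallDefect

variable {E : Type*} [NormedAddCommGroup E] [InnerProductSpace ℝ E] [FiniteDimensional ℝ E]
  [MeasurableSpace E] [BorelSpace E]

/-- The volume of the part of the unit ball that is moved out of it by the translation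
by `-z`. -/
def ballDefect (z : E) : ℝ≥0∞ := volume (ball (0 : E) 1 ∩ {x | x - z ∉ ball (0 : E) 1})

theorem measurable_ballDefect : Measurable (ballDefect : E → ℝ≥0∞) := by
  have hs : MeasurableSet {p : E × E | p.2 ∈ ball (0 : E) 1 ∩ {x | x - p.1 ∉ ball (0 : E) 1}} := by
    refine (measurable_snd measurableSet_ball).inter ?_
    exact ((measurable_snd.sub measurable_fst) measurableSet_ball).compl
  exact measurable_measure_prodMk_left hs

/-- The reflection exchanging `z` and `w` preserves both the ball and the volume. -/
theorem ballDefect_eq_of_norm_eq {z w : E} (h : ‖z‖ = ‖w‖) : ballDefect z = ballDefect w := by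
  set U := Submodule.reflection (Submodule.span ℝ {z - w})ᗮ
  have hU : U z = w := Submodule.reflection_sub h
  have h1 := U.measurePreserving.measure_preimage_emb U.toHomeomorph.measurableEmbedding
    (ball (0 : E) 1 ∩ {x | x - w ∉ ball (0 : E) 1})
  rw [ballDefect, ballDefect, ← h1]
  congr 1
  ext x
  simp only [mem_inter_iff, mem_ball_zero_iff, mem_ofPred_eq, mem_preimage, ← hU, ← map_sub,
    LinearIsometryEquiv.norm_map]

theorem ballDefect_le (z : E) : ballDefect z ≤ volume (ball (0 : E) 1) :=
  measure_mono inter_subset_left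

/-- The part moved out lies in the shell 1 - |z| ≤ |x| < 1, and Bernoulli's inequality bounds the
volume of the shell. This linear decay absorbs one power of the singularity of the kernel at the
origin. -/
theorem ballDefect_le_mul_norm [Nontrivial E] {z : E} (hz : ‖z‖ ≤ 1) :
    ballDefect z ≤ ENNReal.ofReal (Module.finrank ℝ E * ‖z‖) * volume (ball (0 : E) 1) := by
  have h1 : ball (0 : E) 1 ∩ {x | x - z ∉ ball (0 : E) 1} ⊆ ball 0 1 \ ball 0 (1 - ‖z‖) := by
    rintro x ⟨hx, hxz⟩
    refine ⟨hx, fun hx' => hxz ?_⟩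
    rw [mem_ball_zero_iff] at *
    linarith [norm_sub_le x z]
  refine (measure_mono h1).trans ?_
  rw [measure_sdiff (ball_subset_ball (by linarith [norm_nonneg z]))
    measurableSet_ball.nullMeasurableSet measure_ball_lt_top.ne, tsub_le_iff_right,
    Measure.addHaar_ball volume _ (by linarith : 0 ≤ 1 - ‖z‖), ← add_mul,
    ← ENNReal.ofReal_add (by positivity) (pow_nonneg (by linarith) _)]
  have h2 : (1 : ℝ) ≤ Module.finrank ℝ E * ‖z‖ + (1 - ‖z‖) ^ Module.finrank ℝ E := by
    have := one_add_mul_le_pow (a := -‖z‖) (by linarith) (Module.finrank ℝ E)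
    rw [← sub_eq_add_neg] at this
    linarith
  calc volume (ball (0 : E) 1) = 1 * volume (ball (0 : E) 1) := (one_mul _).symm
    _ ≤ _ := by gcongr; exact ENNReal.one_le_ofReal.2 h2

theorem ballDefect_eq {z : E} (hz : 2 ≤ ‖z‖) : ballDefect z = volume (ball (0 : E) 1) := by
  refine le_antisymm (ballDefect_le z) (measure_mono fun x hx => ⟨hx, fun hxz => ?_⟩)
  rw [mem_ball_zero_iff] at *
  linarith [norm_sub_norm_le z x, norm_sub_rev z x]

/-- Substitute z = x - y and integrate first in x: the points x of the ball with x - z outside it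
have measure `ballDefect z`. -/
theorem lintegral_ball_lintegral_compl_ball {k : E → ℝ≥0∞} (hk : Measurable k) :
    ∫⁻ x in ball (0 : E) 1, ∫⁻ y in (ball (0 : E) 1)ᶜ, k (x - y) =
      ∫⁻ z, k z * ballDefect z := by
  have h1 : ∀ x : E, ∫⁻ y in (ball (0 : E) 1)ᶜ, k (x - y) =
      ∫⁻ z, (ball (0 : E) 1)ᶜ.indicator 1 (x - z) * k z := fun x => by
    rw [← lintegral_indicator measurableSet_ball.compl, ← lintegral_sub_left_eq_self _ x]
    refine lintegral_congr fun y => ?_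
    by_cases h : x - y ∈ ball (0 : E) 1 <;> simp [indicator, h]
  simp_rw [h1]
  have hm : Measurable fun p : E × E => (ball (0 : E) 1)ᶜ.indicator (1 : E → ℝ≥0∞) (p.1 - p.2) :=
    (measurable_one.indicator measurableSet_ball.compl).comp (measurable_fst.sub measurable_snd)
  rw [lintegral_lintegral_swap]
  · refine lintegral_congr fun z => ?_
    have hS : MeasurableSet {x : E | x - z ∉ ball (0 : E) 1} :=
      ((measurable_id.sub_const z) measurableSet_ball).compl
    have h2 : ∀ x : E, (ball (0 : E) 1)ᶜ.indicator 1 (x - z) * k z =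
        {x : E | x - z ∉ ball (0 : E) 1}.indicator (fun _ => k z) x := fun x => by
      by_cases h : x - z ∈ ball (0 : E) 1 <;> simp only [indicator, mem_compl_iff, h,
        mem_ofPred_eq, not_true, not_false_iff, if_true, if_false, zero_mul, Pi.one_apply, one_mul]
    simp_rw [h2]
    rw [lintegral_indicator_const hS, Measure.restrict_apply hS, inter_comm, ballDefect]
  · exact (hm.mul (hk.comp measurable_snd)).aemeasurable

/-- Since the weight is radial and |D(rω)| = r|Dω|, the integrand is a product in polar coordinates,
and r^{n-1} r^{-(n+α)} = r^{-1-α}. The constant κ is the remaining radial integral. -/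
theorem exists_lintegral_mul_ballDefect [Nontrivial E] {α : ℝ} (hα : 0 < α) (hα1 : α < 1) :
    ∃ κ : ℝ, 0 < κ ∧ ∀ D : E →L[ℝ] E,
      ∫⁻ z, ENNReal.ofReal (1 / ‖D z‖ ^ ((Module.finrank ℝ E : ℝ) + α)) * ballDefect z =
        ENNReal.ofReal κ * ∫⁻ ω : sphere (0 : E) 1,
          ENNReal.ofReal (1 / ‖D ω‖ ^ ((Module.finrank ℝ E : ℝ) + α)) ∂volume.toSphere := by
  obtain ⟨e, he⟩ : ∃ e : E, ‖e‖ = 1 := exists_norm_eq E zero_le_one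
  set n := Module.finrank ℝ E with hn
  have hn1 : 1 ≤ n := Module.finrank_pos
  set V := volume (ball (0 : E) 1) with hV
  have hVfin : V ≠ ⊤ := measure_ball_lt_top.ne
  have hV0 : V ≠ 0 := (measure_ball_pos volume _ one_pos).ne'
  set κ : ℝ≥0∞ := ∫⁻ r in Ioi (0 : ℝ), ENNReal.ofReal (r ^ (-1 - α)) * ballDefect (r • e) with hκ
  have hre : ∀ r : ℝ, 0 < r → ‖r • e‖ = r := fun r hr => by
    rw [norm_smul, he, mul_one, Real.norm_of_nonneg hr.le]
  have hfin : κ < ⊤ := by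
    -- Near 0 the linear bound on the weight leaves r^{-α}, integrable because α < 1. Near infinity
    -- the weight is bounded and r^{-1-α} is integrable because α > 0.
    have hsplit : Ioi (0 : ℝ) = Ioc 0 1 ∪ Ioi 1 := (Ioc_union_Ioi_eq_Ioi zero_le_one).symm
    rw [hκ, hsplit]
    refine (lintegral_union_le _ _ _).trans_lt (ENNReal.add_lt_top.2 ⟨?_, ?_⟩)
    · have hi : IntegrableOn (fun r : ℝ => r ^ (-α)) (Ioc 0 1) :=
        (intervalIntegral.intervalIntegrable_rpow' (a := 0) (b := 1) (by linarith)).1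
      refine lt_of_le_of_lt (setLIntegral_mono' (g := fun r =>
        ENNReal.ofReal (r ^ (-α)) * (ENNReal.ofReal n * V)) measurableSet_Ioc fun r hr => ?_) ?_
      · refine (mul_le_mul_right (ballDefect_le_mul_norm (by rw [hre r hr.1]; exact hr.2)) _).trans ?_
        rw [hre r hr.1, ← mul_assoc, ← mul_assoc, ← ENNReal.ofReal_mul (Real.rpow_nonneg hr.1.le _),
          ← ENNReal.ofReal_mul (Real.rpow_nonneg hr.1.le _)]
        refine le_of_eq ?_
        congr 2
        rw [mul_comm (n : ℝ) r, ← mul_assoc, ← Real.rpow_add_one hr.1.ne']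
        congr 2
        ring
      · rw [lintegral_mul_const' _ _ (ENNReal.mul_ne_top ENNReal.ofReal_ne_top hVfin)]
        refine ENNReal.mul_lt_top ?_ (ENNReal.mul_lt_top ENNReal.ofReal_lt_top hVfin.lt_top)
        exact (hasFiniteIntegral_iff_ofReal ((ae_restrict_mem measurableSet_Ioc).mono
          fun r hr => Real.rpow_nonneg hr.1.le _)).1 hi.2
    · have hi : IntegrableOn (fun r : ℝ => r ^ (-1 - α)) (Ioi 1) :=
        integrableOn_Ioi_rpow_of_lt (by linarith) one_pos
      refine lt_of_le_of_lt (setLIntegral_mono' (g := fun r =>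
        ENNReal.ofReal (r ^ (-1 - α)) * V) measurableSet_Ioi fun r hr =>
          mul_le_mul_right (ballDefect_le _) _) ?_
      rw [lintegral_mul_const' _ _ hVfin]
      refine ENNReal.mul_lt_top ?_ hVfin.lt_top
      exact (hasFiniteIntegral_iff_ofReal ((ae_restrict_mem measurableSet_Ioi).mono
          fun r hr => Real.rpow_nonneg (zero_le_one.trans (le_of_lt hr)) _)).1 hi.2
  have hpos : 0 < κ := by
    have hm : Measurable fun r : ℝ => ENNReal.ofReal (r ^ (-1 - α)) * ballDefect (r • e) :=
      (by fun_prop : Measurable fun r : ℝ => ENNReal.ofReal (r ^ (-1 - α))).mul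
        (measurable_ballDefect.comp (by fun_prop))
    rw [hκ, setLIntegral_pos_iff hm]
    refine lt_of_lt_of_le (b := volume (Ioi (2 : ℝ))) (by simp) (measure_mono fun r hr => ?_)
    have hr2 : (2 : ℝ) < r := hr
    have hr0 : 0 < r := by linarith
    refine ⟨?_, hr0⟩
    rw [Function.mem_support, ballDefect_eq (by rw [hre r hr0]; exact hr2.le)]
    exact mul_ne_zero (ENNReal.ofReal_pos.2 (Real.rpow_pos_of_pos hr0 _)).ne' hV0
  refine ⟨κ.toReal, ENNReal.toReal_pos hpos.ne' hfin.ne, fun D => ?_⟩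
  have hmeas : Measurable fun z : E => ENNReal.ofReal (1 / ‖D z‖ ^ ((n : ℝ) + α)) := by fun_prop
  rw [ENNReal.ofReal_toReal hfin.ne, lintegral_eq_lintegral_toSphere volume
    (f := fun z => ENNReal.ofReal (1 / ‖D z‖ ^ ((n : ℝ) + α)) * ballDefect z)
    (hmeas.mul measurable_ballDefect), mul_comm κ, ← lintegral_mul_const' _ _ hfin.ne]
  refine lintegral_congr fun ω => ?_
  rw [hκ, ← lintegral_const_mul' _ _ ENNReal.ofReal_ne_top]
  refine setLIntegral_congr_fun measurableSet_Ioi fun r (hr : 0 < r) => ?_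
  have hω : ‖(ω : E)‖ = 1 := norm_eq_of_mem_sphere ω
  rw [ballDefect_eq_of_norm_eq (w := r • e) (by rw [norm_smul, norm_smul, hω, he]), ← mul_assoc,
    ← mul_assoc, ← ENNReal.ofReal_mul (by positivity), ← ENNReal.ofReal_mul (by positivity)]
  congr 2
  rw [map_smul, norm_smul, Real.norm_of_nonneg hr.le, Real.mul_rpow hr.le (norm_nonneg _),
    one_div, one_div, mul_inv, ← mul_assoc, mul_comm (_⁻¹) (r ^ (-1 - α))]
  congr 1
  rw [← Real.rpow_neg hr.le, ← Real.rpow_natCast, ← Real.rpow_add hr, ← hn, Nat.cast_sub hn1]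
  congr 1
  push_cast
  ring

end BallDefect

/-- The second derivative is h^{a-2} (K a(a-1) - b(b-1) h^{b-a}), and h^{b-a} is bounded on the
interval, so a large K makes it nonnegative. -/
theorem exists_convexOn_mul_rpow_sub_rpow {a : ℝ} (ha : 1 < a) (b : ℝ) :
    ∃ K : ℝ, 0 < K ∧ ConvexOn ℝ (Icc (1 / 2) 2) fun h : ℝ => K * h ^ a - h ^ b := by
  have hcont : ContinuousOn (fun h : ℝ => h ^ (b - a)) (Icc (1 / 2) 2) :=
    continuousOn_id.rpow_const fun x hx => Or.inl (by linarith [hx.1] : (0 : ℝ) < x).ne'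
  obtain ⟨C, hC⟩ := isCompact_Icc.exists_bound_of_continuousOn hcont
  have haa : 0 < a * (a - 1) := mul_pos (by linarith) (by linarith)
  have hC0 : 0 ≤ C := (norm_nonneg _).trans (hC 1 (by norm_num))
  set K : ℝ := (|b * (b - 1)| * C + 1) / (a * (a - 1)) with hK
  refine ⟨K, by positivity, convexOn_of_hasDerivWithinAt2_nonneg (convex_Icc _ _)
    (f' := fun h => K * (a * h ^ (a - 1)) - b * h ^ (b - 1))
    (f'' := fun h => K * (a * ((a - 1) * h ^ (a - 1 - 1))) - b * ((b - 1) * h ^ (b - 1 - 1)))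
    ?_ ?_ ?_ ?_⟩
  · have h0 : ∀ x ∈ Icc (1 / 2 : ℝ) 2, x ≠ 0 := fun x hx => (by linarith [hx.1] : (0 : ℝ) < x).ne'
    exact (continuousOn_const.mul (continuousOn_id.rpow_const fun x hx => Or.inl (h0 x hx))).sub
      (continuousOn_id.rpow_const fun x hx => Or.inl (h0 x hx))
  · intro x hx
    rw [interior_Icc] at hx
    have h0 : x ≠ 0 := (by linarith [hx.1] : (0 : ℝ) < x).ne'
    exact (((Real.hasDerivAt_rpow_const (Or.inl h0)).const_mul K).sub
      (Real.hasDerivAt_rpow_const (Or.inl h0))).hasDerivWithinAt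
  · intro x hx
    rw [interior_Icc] at hx
    have h0 : x ≠ 0 := (by linarith [hx.1] : (0 : ℝ) < x).ne'
    exact ((((Real.hasDerivAt_rpow_const (Or.inl h0)).const_mul a).const_mul K).sub
      ((Real.hasDerivAt_rpow_const (Or.inl h0)).const_mul b)).hasDerivWithinAt
  · intro x hx
    have hxI := interior_subset hx
    have h0 : 0 < x := by linarith [hxI.1]
    have h1 : x ^ (b - 1 - 1) = x ^ (b - a) * x ^ (a - 1 - 1) := by
      rw [← Real.rpow_add h0]; ring_nf
    have h2 : K * (a * (a - 1)) = |b * (b - 1)| * C + 1 := div_mul_cancel₀ _ haa.ne'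
    have h3 : b * (b - 1) * x ^ (b - a) ≤ |b * (b - 1)| * C := by
      refine (le_abs_self _).trans ?_
      rw [abs_mul]
      exact mul_le_mul_of_nonneg_left (hC x hxI) (abs_nonneg _)
    have h4 : 0 < x ^ (a - 1 - 1) := Real.rpow_pos_of_pos h0 _
    have h5 : K * (a * ((a - 1) * x ^ (a - 1 - 1))) - b * ((b - 1) * x ^ (b - 1 - 1)) =
        (K * (a * (a - 1)) - b * (b - 1) * x ^ (b - a)) * x ^ (a - 1 - 1) := by rw [h1]; ring
    rw [h5, h2]
    exact mul_nonneg (by linarith) h4.le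

/-! ### Averages of powers of |Dω| over the sphere. -/

section Sphere

theorem continuous_one_div_norm_rpow {E : Type*} [NormedAddCommGroup E] [InnerProductSpace ℝ E]
    (D : E ≃L[ℝ] E) (p : ℝ) :
    Continuous fun ω : sphere (0 : E) 1 => 1 / ‖D ω‖ ^ p := by
  have h0 : ∀ ω : sphere (0 : E) 1, ‖D ω‖ ≠ 0 := fun ω =>
    norm_ne_zero_iff.2 (by simpa using ne_zero_of_mem_unit_sphere ω)
  refine continuous_const.div (Continuous.rpow_const (by fun_prop) fun ω => Or.inl (h0 ω))
    fun ω => (Real.rpow_pos_of_pos ((norm_nonneg _).lt_of_ne' (h0 ω)) p).ne'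

theorem integrable_sphere {E : Type*} [NormedAddCommGroup E] [InnerProductSpace ℝ E]
    [FiniteDimensional ℝ E] [MeasurableSpace E] [BorelSpace E] {g : sphere (0 : E) 1 → ℝ} (hg : Continuous g) :
    Integrable g (volume : Measure E).toSphere :=
  hg.integrable_of_hasCompactSupport (HasCompactSupport.of_compactSpace g)

variable {E : Type*} [NormedAddCommGroup E] [InnerProductSpace ℝ E] [FiniteDimensional ℝ E]
  [Nontrivial E] [MeasurableSpace E] [BorelSpace E]

/-- Along the ray through ω the integrand is constant up to r = 1/|Dω|, where D(rω) leaves the ball,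
and the integral of r^{n-1} up to there is 1/(n|Dω|^n). -/
theorem lintegral_ball_indicator_comp (D : E ≃L[ℝ] E) {f : E → ℝ≥0∞} (hf : Measurable f) :
    ∫⁻ x, (ball (0 : E) 1).indicator (fun y => f (‖y‖⁻¹ • y)) (D x) =
      ENNReal.ofReal (1 / Module.finrank ℝ E) * ∫⁻ ω : sphere (0 : E) 1,
        ENNReal.ofReal (1 / ‖D ω‖ ^ Module.finrank ℝ E) * f (‖D ω‖⁻¹ • D ω)
          ∂volume.toSphere := by
  set n := Module.finrank ℝ E with hn
  have hn1 : 1 ≤ n := Module.finrank_pos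
  have hm : Measurable fun x => (ball (0 : E) 1).indicator (fun y => f (‖y‖⁻¹ • y)) (D x) :=
    Measurable.comp (Measurable.indicator (hf.comp (by fun_prop)) measurableSet_ball) (by fun_prop)
  rw [lintegral_eq_lintegral_toSphere volume hm, ← lintegral_const_mul' _ _ ENNReal.ofReal_ne_top]
  refine lintegral_congr fun ω => ?_
  have hω : (ω : E) ≠ 0 := ne_zero_of_mem_unit_sphere ω
  have hD : 0 < ‖D ω‖ := norm_pos_iff.2 (by simpa using hω)
  have h1 : ∀ r ∈ Ioi (0 : ℝ), ENNReal.ofReal (r ^ (n - 1)) *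
      (ball (0 : E) 1).indicator (fun y => f (‖y‖⁻¹ • y)) (D (r • (ω : E))) =
      (Iio ‖D ω‖⁻¹).indicator
        (fun r : ℝ => ENNReal.ofReal (r ^ (n - 1)) * f (‖D ω‖⁻¹ • D ω)) r := by
    intro r hr
    have hr0 : 0 < r := hr
    have hnorm : ‖D (r • (ω : E))‖ = r * ‖D ω‖ := by
      rw [map_smul, norm_smul, Real.norm_of_nonneg hr0.le]
    have hiff : D (r • (ω : E)) ∈ ball (0 : E) 1 ↔ r ∈ Iio ‖D ω‖⁻¹ := by
      rw [mem_ball_zero_iff, hnorm, mem_Iio, lt_inv_comm₀ hr0 hD, ← one_div, lt_div_iff₀ hr0,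
        mul_comm]
    by_cases h : r ∈ Iio ‖D ω‖⁻¹
    · rw [indicator_of_mem (hiff.2 h), indicator_of_mem h, hnorm, map_smul, smul_smul]
      congr 3
      field_simp
    · rw [indicator_of_notMem (fun h' => h (hiff.1 h')), indicator_of_notMem h, mul_zero]
  rw [setLIntegral_congr_fun measurableSet_Ioi h1, setLIntegral_indicator measurableSet_Iio,
    inter_comm, Ioi_inter_Iio, lintegral_mul_const _ (by fun_prop), ← mul_assoc,
    ← ENNReal.ofReal_mul (by positivity)]
  congr 1
  have hd : 0 ≤ ‖D ω‖⁻¹ := by positivity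
  rw [Measure.restrict_congr_set Ioo_ae_eq_Ioc, ← ofReal_integral_eq_lintegral_ofReal
    (intervalIntegral.intervalIntegrable_pow _).1, ← intervalIntegral.integral_of_le hd]
  · rw [integral_pow, Nat.sub_add_cancel hn1, zero_pow (by omega), Nat.cast_sub hn1]
    congr 1
    rw [inv_pow]
    push_cast
    ring
  · filter_upwards [ae_restrict_mem measurableSet_Ioc] with y hy using pow_nonneg hy.1.le _

/-- A volume preserving linear map moves the surface measure of the unit sphere, under central
projection, with the density `ω ↦ 1 / |D ω|^n`. -/
theorem lintegral_sphere_comp (D : E ≃L[ℝ] E) (hD : MeasurePreserving D volume volume)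
    {f : E → ℝ≥0∞} (hf : Measurable f) :
    ∫⁻ ω : sphere (0 : E) 1, ENNReal.ofReal (1 / ‖D ω‖ ^ Module.finrank ℝ E) *
        f (‖D ω‖⁻¹ • D ω) ∂volume.toSphere =
      ∫⁻ ω : sphere (0 : E) 1, f ω ∂volume.toSphere := by
  have hn1 : 0 < Module.finrank ℝ E := Module.finrank_pos
  have h1 := lintegral_ball_indicator_comp D hf
  have h2 := lintegral_ball_indicator_comp (ContinuousLinearEquiv.refl ℝ E) hf
  have hm : Measurable ((ball (0 : E) 1).indicator (fun y => f (‖y‖⁻¹ • y))) :=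
    Measurable.indicator (hf.comp (by fun_prop)) measurableSet_ball
  -- Preservation of volume identifies the solid integral for `D` with that for the identity;
  -- comparing the two polar formulas gives the claim.
  rw [hD.lintegral_comp hm] at h1
  rw [show (∫⁻ x, (ball (0 : E) 1).indicator (fun y => f (‖y‖⁻¹ • y))
    (ContinuousLinearEquiv.refl ℝ E x)) = ∫⁻ x, (ball (0 : E) 1).indicator
      (fun y => f (‖y‖⁻¹ • y)) x from rfl, h1] at h2
  have h3 := (ENNReal.mul_right_inj (by
    simpa using hn1.ne') ENNReal.ofReal_ne_top).1 h2
  rw [h3]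
  refine lintegral_congr fun ω => ?_
  simp [norm_eq_of_mem_sphere ω]

theorem integral_sphere_comp (D : E ≃L[ℝ] E) (hD : MeasurePreserving D volume volume)
    {f : E → ℝ} (hf : Continuous f) (hf0 : ∀ x, 0 ≤ f x) :
    ∫ ω : sphere (0 : E) 1, 1 / ‖D ω‖ ^ (Module.finrank ℝ E : ℝ) *
        f (‖D ω‖⁻¹ • D ω) ∂volume.toSphere =
      ∫ ω : sphere (0 : E) 1, f ω ∂volume.toSphere := by
  have h := lintegral_sphere_comp D hD (f := fun x => ENNReal.ofReal (f x)) (by fun_prop)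
  have h0 : ∀ ω : sphere (0 : E) 1, ‖D ω‖ ≠ 0 := fun ω =>
    norm_ne_zero_iff.2 (by simpa using ne_zero_of_mem_unit_sphere ω)
  rw [integral_eq_lintegral_of_nonneg_ae (Filter.Eventually.of_forall fun ω => by
      have := hf0 (‖D ω‖⁻¹ • D ω); positivity),
    integral_eq_lintegral_of_nonneg_ae (f := fun ω : sphere (0 : E) 1 => f ω)
      (Filter.Eventually.of_forall fun ω => hf0 ω), ← h]
  · congr 1
    refine lintegral_congr fun ω => ?_
    rw [ENNReal.ofReal_mul (by positivity), Real.rpow_natCast]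
  · exact (hf.comp continuous_subtype_val).aestronglyMeasurable
  · refine Continuous.aestronglyMeasurable ((continuous_one_div_norm_rpow D _).mul
      (hf.comp (Continuous.smul (Continuous.inv₀ (by fun_prop) h0) (by fun_prop))))

theorem integral_one_div_norm_rpow_finrank (D : E ≃L[ℝ] E)
    (hD : MeasurePreserving D volume volume) :
    ∫ ω : sphere (0 : E) 1, 1 / ‖D ω‖ ^ (Module.finrank ℝ E : ℝ) ∂volume.toSphere =
      (volume : Measure E).toSphere.real univ := by
  simpa using integral_sphere_comp D hD (f := fun _ => 1) continuous_const fun _ => zero_le_one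

/-- At the projected point Dω/|Dω| the integrand |D⁻¹·| equals 1/|Dω|, which supplies the extra
power. This puts the classical perimeter in the form of the fractional ones, with exponent 1. -/
theorem integral_norm_symm (D : E ≃L[ℝ] E) (hD : MeasurePreserving D volume volume) :
    ∫ ω : sphere (0 : E) 1, ‖D.symm ω‖ ∂volume.toSphere =
      ∫ ω : sphere (0 : E) 1, 1 / ‖D ω‖ ^ ((Module.finrank ℝ E : ℝ) + 1) ∂volume.toSphere := by
  rw [← integral_sphere_comp D hD (f := fun x => ‖D.symm x‖) (by fun_prop)
    fun _ => norm_nonneg _]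
  refine integral_congr_ae (Filter.Eventually.of_forall fun ω => ?_)
  have h0 : ‖D ω‖ ≠ 0 := norm_ne_zero_iff.2 (by simpa using ne_zero_of_mem_unit_sphere ω)
  simp only [map_smul, D.symm_apply_apply, norm_smul, norm_inv, norm_norm, norm_eq_of_mem_sphere ω]
  rw [Real.rpow_add_one h0]
  field_simp

/-- The averages over the unit sphere of the powers of `|D ω|`, for a volume preserving `D` which
is near an isometry without being one. -/
theorem exists_integral_one_div_norm_rpow_sub_le {s : ℝ} (hs : 0 < s) (t : ℝ) :
    ∃ K : ℝ, 0 < K ∧ ∀ D : E ≃L[ℝ] E, MeasurePreserving D volume volume →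
      (∀ ω : sphere (0 : E) 1, 1 / ‖D ω‖ ^ (Module.finrank ℝ E : ℝ) ∈ Icc (1 / 2 : ℝ) 2) →
      (∃ ω : sphere (0 : E) 1, ‖D ω‖ ≠ 1) →
      0 < (∫ ω : sphere (0 : E) 1, 1 / ‖D ω‖ ^ ((Module.finrank ℝ E : ℝ) + s) ∂volume.toSphere) -
        (volume : Measure E).toSphere.real univ ∧
      (∫ ω : sphere (0 : E) 1, 1 / ‖D ω‖ ^ ((Module.finrank ℝ E : ℝ) + t) ∂volume.toSphere) -
        (volume : Measure E).toSphere.real univ ≤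
      K * ((∫ ω : sphere (0 : E) 1, 1 / ‖D ω‖ ^ ((Module.finrank ℝ E : ℝ) + s)
        ∂volume.toSphere) - (volume : Measure E).toSphere.real univ) := by
  set n : ℝ := (Module.finrank ℝ E : ℝ) with hn
  have hn0 : 0 < n := Nat.cast_pos.2 Module.finrank_pos
  have ha : 1 < 1 + s / n := by linarith [div_pos hs hn0]
  obtain ⟨K, hK0, hK⟩ := exists_convexOn_mul_rpow_sub_rpow ha (1 + t / n)
  refine ⟨K, hK0, fun D hD hmem hne => ?_⟩
  set σ := (volume : Measure E).toSphere
  set h : sphere (0 : E) 1 → ℝ := fun ω => 1 / ‖D ω‖ ^ n with hh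
  have hcont : ∀ p : ℝ, Continuous fun ω : sphere (0 : E) 1 => 1 / ‖D ω‖ ^ p :=
    continuous_one_div_norm_rpow D
  have hint : ∀ p : ℝ, Integrable (fun ω : sphere (0 : E) 1 => 1 / ‖D ω‖ ^ p) σ := fun p =>
    integrable_sphere (hcont p)
  have hpow : ∀ (p : ℝ) (ω : sphere (0 : E) 1), h ω ^ (1 + p / n) = 1 / ‖D ω‖ ^ (n + p) := by
    intro p ω
    rw [hh, Real.div_rpow zero_le_one (by positivity), Real.one_rpow,
      ← Real.rpow_mul (norm_nonneg _)]
    congr 2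
    field_simp
  have hJ : ∫ ω, h ω ∂σ = σ.real univ := integral_one_div_norm_rpow_finrank D hD
  have hσ : 0 < σ.real univ := by
    refine ENNReal.toReal_pos ?_ (measure_ne_top _ _)
    exact Measure.measure_univ_ne_zero.2 (Measure.toSphere_ne_zero _)
  constructor
  -- Bernoulli: the power lies above its tangent line at 1, strictly where h ≠ 1. As h has mean 1,
  -- the tangent line integrates to the area of the sphere.
  · have hb : ∀ ω, 0 ≤ h ω ^ (1 + s / n) - (1 + (1 + s / n) * (h ω - 1)) := fun ω => by
      have := one_add_mul_self_le_rpow_one_add (s := h ω - 1) (by linarith [(hmem ω).1]) ha.le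
      rw [add_sub_cancel] at this
      linarith
    have hc : Continuous fun ω => h ω ^ (1 + s / n) - (1 + (1 + s / n) * (h ω - 1)) := by
      simp_rw [hpow]
      exact (hcont _).sub (continuous_const.add (continuous_const.mul
        ((hcont n).sub continuous_const)))
    obtain ⟨ω₀, hω₀⟩ := hne
    have hpos : 0 < ∫ ω, (h ω ^ (1 + s / n) - (1 + (1 + s / n) * (h ω - 1))) ∂σ := by
      refine hc.integral_pos_of_hasCompactSupport_nonneg_nonzero
        (HasCompactSupport.of_compactSpace _) hb (x := ω₀) ?_
      have h1 : h ω₀ - 1 ≠ 0 := by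
        intro h0
        have h2 : ‖D ω₀‖ ^ n = 1 := by
          have : 1 / ‖D ω₀‖ ^ n = 1 := by linarith
          rw [div_eq_one_iff_eq] at this
          · exact this.symm
          · intro h3; rw [h3] at this; simp at this
        exact hω₀ (Real.rpow_left_injOn hn0.ne' (norm_nonneg _) (zero_le_one' ℝ)
          (h2.trans (Real.one_rpow n).symm))
      have := one_add_mul_self_lt_rpow_one_add (s := h ω₀ - 1) (by linarith [(hmem ω₀).1]) h1 ha
      rw [add_sub_cancel] at this
      exact (sub_pos.2 this).ne'
    simp_rw [hpow] at hpos
    set c := 1 + s / n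
    have he : ∫ ω, (1 / ‖D ω‖ ^ (n + s) - (1 + c * (h ω - 1))) ∂σ =
        (∫ ω, 1 / ‖D ω‖ ^ (n + s) ∂σ) - σ.real univ := by
      have h1 : ∀ ω : sphere (0 : E) 1, 1 / ‖D ω‖ ^ (n + s) - (1 + c * (h ω - 1)) =
          1 / ‖D ω‖ ^ (n + s) - (c * h ω + (1 - c)) := fun ω => by ring
      have h2 : Integrable (fun ω => c * h ω) σ := (hint n).const_mul c
      have h3 : Integrable (fun ω => c * h ω + (1 - c)) σ := h2.add (integrable_const _)
      simp_rw [h1]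
      rw [integral_sub (hint _) h3, integral_add h2 (integrable_const _), integral_const_mul, hJ,
        integral_const, smul_eq_mul]
      ring
    rwa [he] at hpos
  · have : NeZero σ := ⟨Measure.toSphere_ne_zero _⟩
    have hi2 : Integrable (fun ω => K * h ω ^ (1 + s / n) - h ω ^ (1 + t / n)) σ := by
      simp_rw [hpow]
      exact ((hint _).const_mul K).sub (hint _)
    have hcK : ContinuousOn (fun h : ℝ => K * h ^ (1 + s / n) - h ^ (1 + t / n))
        (Icc (1 / 2) 2) := by
      have h0 : ∀ x ∈ Icc (1 / 2 : ℝ) 2, x ≠ 0 := fun x hx =>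
        (by linarith [hx.1] : (0 : ℝ) < x).ne'
      exact (continuousOn_const.mul (continuousOn_id.rpow_const fun x hx => Or.inl (h0 x hx))).sub
        (continuousOn_id.rpow_const fun x hx => Or.inl (h0 x hx))
    -- The mean of h is 1, where the convex function takes the value K - 1.
    have hJen := hK.map_average_le hcK isClosed_Icc (μ := σ) (f := h)
      (Filter.Eventually.of_forall hmem) (hint n) hi2
    rw [average_eq, average_eq, hJ, smul_eq_mul, inv_mul_cancel₀ hσ.ne', Real.one_rpow,
      Real.one_rpow, smul_eq_mul, inv_mul_eq_div, le_div_iff₀ hσ] at hJen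
    simp only [hpow] at hJen
    rw [integral_sub ((hint _).const_mul K) (hint _), integral_const_mul] at hJen
    linarith

end Sphere

/-! ### Integration by parts and the flux bound on the unit ball. -/

section Divergence

variable {N : ℕ}

theorem divergence_eq_trace (T : EuclideanSpace ℝ (Fin N) → EuclideanSpace ℝ (Fin N))
    (x : EuclideanSpace ℝ (Fin N)) :
    divergence T x = LinearMap.trace ℝ _ (fderiv ℝ T x).toLinearMap := by
  rw [LinearMap.trace_eq_sum_inner _ (EuclideanSpace.basisFun (Fin N) ℝ), divergence]
  refine Finset.sum_congr rfl fun i _ => ?_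
  rw [EuclideanSpace.basisFun_apply, EuclideanSpace.inner_single_left]
  simp

theorem continuous_divergence {T : EuclideanSpace ℝ (Fin N) → EuclideanSpace ℝ (Fin N)}
    (hT : ContDiff ℝ 1 T) : Continuous (divergence T) := by
  have h := hT.continuous_fderiv one_ne_zero
  unfold divergence
  fun_prop

theorem hasCompactSupport_divergence
    {T : EuclideanSpace ℝ (Fin N) → EuclideanSpace ℝ (Fin N)} (hT : HasCompactSupport T) :
    HasCompactSupport (divergence T) := by
  have h := (hT.fderiv (𝕜 := ℝ)).comp_left (g := fun A : EuclideanSpace ℝ (Fin N) →L[ℝ]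
    EuclideanSpace ℝ (Fin N) => ∑ i : Fin N, A (EuclideanSpace.single i 1) i) (by simp)
  exact h

theorem integral_mul_divergence {φ : EuclideanSpace ℝ (Fin N) → ℝ}
    {T : EuclideanSpace ℝ (Fin N) → EuclideanSpace ℝ (Fin N)} (hφ : ContDiff ℝ 1 φ)
    (hT : ContDiff ℝ 1 T) (hTc : HasCompactSupport T) :
    ∫ x, φ x * divergence T x = - ∫ x, fderiv ℝ φ x (T x) := by
  have hφ' := hφ.continuous_fderiv one_ne_zero
  have hTi : ∀ i, ContDiff ℝ 1 fun x => T x i := fun i => contDiff_euclidean.1 hT i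
  have hTi' : ∀ i, Continuous (fderiv ℝ fun x => T x i) := fun i =>
    (hTi i).continuous_fderiv one_ne_zero
  have hTic : ∀ i, HasCompactSupport fun x => T x i := fun i =>
    hTc.comp_left (g := fun y : EuclideanSpace ℝ (Fin N) => y i) rfl
  have hTf : ∀ i x, fderiv ℝ (fun x => T x i) x (EuclideanSpace.single i 1) =
      fderiv ℝ T x (EuclideanSpace.single i 1) i := fun i x => by
    have h1 := (EuclideanSpace.proj i : EuclideanSpace ℝ (Fin N) →L[ℝ] ℝ).hasFDerivAt.comp x
      (hT.differentiable one_ne_zero x).hasFDerivAt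
    exact congrArg (fun A => A (EuclideanSpace.single i 1)) h1.fderiv
  have hint1 : ∀ i, Integrable fun x => φ x * fderiv ℝ (fun x => T x i) x
      (EuclideanSpace.single i 1) := fun i =>
    Continuous.integrable_of_hasCompactSupport (by have := hφ.continuous; have := hTi' i; fun_prop)
      (((hTic i).fderiv_apply (𝕜 := ℝ) _).mul_left)
  have hint2 : ∀ i, Integrable fun x => fderiv ℝ φ x (EuclideanSpace.single i 1) * T x i :=
    fun i => Continuous.integrable_of_hasCompactSupport
      (by have := hT.continuous; fun_prop) (hTic i).mul_left
  have hint3 : ∀ i, Integrable fun x => φ x * T x i :=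
    fun i => Continuous.integrable_of_hasCompactSupport
      (by have := hT.continuous; have := hφ.continuous; fun_prop) (hTic i).mul_left
  have h1 : ∀ x, φ x * divergence T x =
      ∑ i, φ x * fderiv ℝ (fun x => T x i) x (EuclideanSpace.single i 1) := fun x => by
    simp_rw [divergence, Finset.mul_sum, hTf]
  have h2 : ∀ x, fderiv ℝ φ x (T x) =
      ∑ i, fderiv ℝ φ x (EuclideanSpace.single i 1) * T x i := fun x => by
    conv_lhs => rw [← (EuclideanSpace.basisFun (Fin N) ℝ).sum_repr (T x), map_sum]
    refine Finset.sum_congr rfl fun i _ => ?_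
    simp [mul_comm]
  simp_rw [h1, h2]
  rw [integral_finsetSum _ fun i _ => hint1 i, integral_finsetSum _ fun i _ => hint2 i,
    ← Finset.sum_neg_distrib]
  refine Finset.sum_congr rfl fun i _ => ?_
  exact integral_mul_fderiv_eq_neg_fderiv_mul_of_integrable (hint2 i) (hint1 i) (hint3 i)
    (fun x _ => hφ.differentiable one_ne_zero x) fun x _ => (hTi i).differentiable one_ne_zero x

/-- In polar coordinates |M(rω)| = r|Mω|, and -ψ'(r²) 2r dr has total mass ψ(0) = 1. It lives on r ≤
1, so the Jacobian r^{n-1} is at most 1 and may be dropped. -/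
theorem integral_radial_mul_norm_le {E : Type*} [NormedAddCommGroup E] [InnerProductSpace ℝ E]
    [FiniteDimensional ℝ E] [Nontrivial E] [MeasurableSpace E] [BorelSpace E] {ψ : ℝ → ℝ}
    (hψ : ContDiff ℝ 1 ψ) (hanti : Antitone ψ) (h0 : ψ 0 = 1) (h1 : ∀ u, 1 ≤ u → ψ u = 0)
    (M : E →L[ℝ] E) :
    ∫ x : E, -deriv ψ (‖x‖ ^ 2) * (2 * ‖M x‖) ≤
      ∫ ω : sphere (0 : E) 1, ‖M ω‖ ∂volume.toSphere := by
  have hψ' : Continuous (deriv ψ) := hψ.continuous_deriv le_rfl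
  have hnn : ∀ u, 0 ≤ -deriv ψ u := fun u => neg_nonneg.2 hanti.deriv_nonpos
  have hz : ∀ u, 1 < u → deriv ψ u = 0 := fun u hu => by
    have : ψ =ᶠ[nhds u] fun _ => 0 := by
      filter_upwards [Ioi_mem_nhds hu] with v hv using h1 v (le_of_lt hv)
    rw [this.deriv_eq, deriv_const]
  have hder : ∀ r ∈ Ici (0 : ℝ), HasDerivAt (fun r : ℝ => -ψ (r ^ 2))
      (-deriv ψ (r ^ 2) * (2 * r)) r := fun r _ => by
    have := ((hψ.differentiable one_ne_zero (r ^ 2)).hasDerivAt.comp r (hasDerivAt_pow 2 r)).neg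
    exact this.congr_deriv (by simp)
  have hpos : ∀ r ∈ Ioi (0 : ℝ), 0 ≤ -deriv ψ (r ^ 2) * (2 * r) := fun r (hr : 0 < r) =>
    mul_nonneg (hnn _) (by linarith)
  have hlim : Filter.Tendsto (fun r : ℝ => -ψ (r ^ 2)) Filter.atTop (nhds 0) := by
    refine tendsto_const_nhds.congr' ?_
    filter_upwards [Filter.eventually_ge_atTop 1] with r hr
    rw [h1 _ (one_le_pow₀ hr), neg_zero]
  have hI : ∫⁻ r in Ioi (0 : ℝ), ENNReal.ofReal (-deriv ψ (r ^ 2) * (2 * r)) = 1 := by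
    rw [← ofReal_integral_eq_lintegral_ofReal (integrableOn_Ioi_deriv_of_nonneg' hder hpos hlim)
      ((ae_restrict_mem measurableSet_Ioi).mono hpos),
      integral_Ioi_of_hasDerivAt_of_nonneg' hder hpos hlim]
    simp [h0]
  have hle : ∫⁻ x : E, ENNReal.ofReal (-deriv ψ (‖x‖ ^ 2) * (2 * ‖M x‖)) ≤
      ∫⁻ ω : sphere (0 : E) 1, ENNReal.ofReal ‖M ω‖ ∂volume.toSphere := by
    rw [lintegral_eq_lintegral_toSphere volume (by fun_prop)]
    refine lintegral_mono fun ω => ?_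
    calc _ ≤ ∫⁻ r in Ioi (0 : ℝ), ENNReal.ofReal (-deriv ψ (r ^ 2) * (2 * r)) *
          ENNReal.ofReal ‖M ω‖ := by
          refine setLIntegral_mono' measurableSet_Ioi fun r (hr : 0 < r) => ?_
          rw [norm_smul, norm_eq_of_mem_sphere ω, mul_one, map_smul, norm_smul,
            Real.norm_of_nonneg hr.le, ← ENNReal.ofReal_mul (by positivity),
            ← ENNReal.ofReal_mul (hpos r hr)]
          refine ENNReal.ofReal_le_ofReal ?_
          rcases le_or_gt r 1 with hr1 | hr1
          · have := pow_le_one₀ (n := Module.finrank ℝ E - 1) hr.le hr1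
            have h3 := mul_nonneg (hpos r hr) (norm_nonneg (M ω))
            nlinarith
          · rw [hz _ (one_lt_pow₀ hr1 two_ne_zero)]
            simp
      _ = ENNReal.ofReal ‖M ω‖ := by
          rw [lintegral_mul_const' _ _ ENNReal.ofReal_ne_top, hI, one_mul]
  have hi : Integrable (fun ω : sphere (0 : E) 1 => ‖M ω‖) (volume : Measure E).toSphere :=
    integrable_sphere (by fun_prop)
  rw [integral_eq_lintegral_of_nonneg_ae (Filter.Eventually.of_forall fun x =>
      mul_nonneg (hnn _) (by positivity)) (Continuous.aestronglyMeasurable (by fun_prop)),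
    integral_eq_lintegral_of_nonneg_ae (Filter.Eventually.of_forall fun ω => norm_nonneg _)
      hi.aestronglyMeasurable]
  refine ENNReal.toReal_mono ?_ hle
  exact ((hasFiniteIntegral_iff_ofReal (Filter.Eventually.of_forall fun ω => norm_nonneg _)).1
    hi.2).ne

variable [Nontrivial (EuclideanSpace ℝ (Fin N))]

/-- One half of the divergence theorem on the unit ball. -/
theorem setIntegral_ball_divergence_le
    {T : EuclideanSpace ℝ (Fin N) → EuclideanSpace ℝ (Fin N)} (hT : ContDiff ℝ 1 T)
    (hTc : HasCompactSupport T) (M : EuclideanSpace ℝ (Fin N) →L[ℝ] EuclideanSpace ℝ (Fin N))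
    (hM : ∀ x, inner ℝ x (T x) ≤ ‖M x‖) :
    ∫ x in ball 0 1, divergence T x ≤
      ∫ ω : sphere (0 : EuclideanSpace ℝ (Fin N)) 1, ‖M ω‖ ∂volume.toSphere := by
  have hdc := continuous_divergence hT
  have hds := hasCompactSupport_divergence hTc
  -- The cutoffs ψ_k(|x|²) vanish outside the open ball and equal 1 where 1 - |x|² ≥ 1/(k+1), so
  -- they converge to its indicator. The flux bound below holds for each k with the same right-hand
  -- side.
  set ψ : ℕ → ℝ → ℝ := fun k u => Real.smoothTransition ((k + 1 : ℝ) * (1 - u)) with hψdef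
  have hψ : ∀ k, ContDiff ℝ 1 (ψ k) := fun k =>
    (Real.smoothTransition.contDiff (n := 1)).comp (by fun_prop)
  have hanti : ∀ k, Antitone (ψ k) := fun k u v huv =>
    Real.smoothTransition.monotone (by gcongr)
  have hψ0 : ∀ k, ψ k 0 = 1 := fun k => Real.smoothTransition.one_of_one_le (by
    have : (0 : ℝ) ≤ k := Nat.cast_nonneg k
    linarith)
  have hψ1 : ∀ k u, 1 ≤ u → ψ k u = 0 := fun k u hu => Real.smoothTransition.zero_of_nonpos
    (mul_nonpos_of_nonneg_of_nonpos (by positivity) (by linarith))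
  have hlim : Filter.Tendsto (fun k => ∫ x, ψ k (‖x‖ ^ 2) * divergence T x) Filter.atTop
      (nhds (∫ x, (ball 0 1).indicator (divergence T) x)) := by
    refine tendsto_integral_of_dominated_convergence (fun x => ‖divergence T x‖)
      (fun k => ?_) (hdc.integrable_of_hasCompactSupport hds).norm (fun k => ?_) ?_
    · have := (hψ k).continuous
      exact Continuous.aestronglyMeasurable (by fun_prop)
    · refine Filter.Eventually.of_forall fun x => ?_
      rw [norm_mul, Real.norm_of_nonneg (Real.smoothTransition.nonneg _)]
      exact mul_le_of_le_one_left (norm_nonneg _) (Real.smoothTransition.le_one _)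
    · refine Filter.Eventually.of_forall fun x => ?_
      by_cases hx : x ∈ ball (0 : EuclideanSpace ℝ (Fin N)) 1
      · rw [indicator_of_mem hx]
        have hx1 : 0 < 1 - ‖x‖ ^ 2 := by
          rw [mem_ball_zero_iff] at hx
          nlinarith [norm_nonneg x]
        refine tendsto_const_nhds.congr' ?_
        filter_upwards [Filter.eventually_ge_atTop ⌈1 / (1 - ‖x‖ ^ 2)⌉₊] with k hk
        have hk1 : 1 / (1 - ‖x‖ ^ 2) ≤ k := Nat.ceil_le.1 hk
        rw [div_le_iff₀ hx1] at hk1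
        simp only [hψdef]
        rw [Real.smoothTransition.one_of_one_le (by linarith), one_mul]
      · rw [indicator_of_notMem hx]
        refine tendsto_const_nhds.congr fun k => ?_
        rw [mem_ball_zero_iff, not_lt] at hx
        rw [hψ1 k _ (one_le_pow₀ hx), zero_mul]
  rw [integral_indicator measurableSet_ball] at hlim
  refine le_of_tendsto' hlim fun k => ?_
  have hφ : ContDiff ℝ 1 fun x : EuclideanSpace ℝ (Fin N) => ψ k (‖x‖ ^ 2) :=
    (hψ k).comp (contDiff_norm_sq ℝ)
  have hφ' : ∀ x : EuclideanSpace ℝ (Fin N), fderiv ℝ (fun x => ψ k (‖x‖ ^ 2)) x (T x) =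
      deriv (ψ k) (‖x‖ ^ 2) * (2 * inner ℝ x (T x)) := fun x => by
    have h := ((hψ k).differentiable one_ne_zero (‖x‖ ^ 2)).hasDerivAt.comp_hasFDerivAt x
      (hasStrictFDerivAt_norm_sq x).hasFDerivAt
    rw [show (fun x : EuclideanSpace ℝ (Fin N) => ψ k (‖x‖ ^ 2)) = ψ k ∘ fun x => ‖x‖ ^ 2 from rfl,
      h.fderiv]
    simp
  have hcd : Continuous (deriv (ψ k)) := (hψ k).continuous_deriv le_rfl
  have hnn : ∀ u, 0 ≤ -deriv (ψ k) u := fun u => neg_nonneg.2 (hanti k).deriv_nonpos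
  have hz : ∀ u, 1 < u → deriv (ψ k) u = 0 := fun u hu => by
    have : ψ k =ᶠ[nhds u] fun _ => 0 := by
      filter_upwards [Ioi_mem_nhds hu] with v hv using hψ1 k v (le_of_lt hv)
    rw [this.deriv_eq, deriv_const]
  have hcs : HasCompactSupport fun x : EuclideanSpace ℝ (Fin N) =>
      -deriv (ψ k) (‖x‖ ^ 2) * (2 * ‖M x‖) := by
    refine HasCompactSupport.intro (isCompact_closedBall 0 1) fun x hx => ?_
    rw [mem_closedBall_zero_iff, not_le] at hx
    rw [hz _ (one_lt_pow₀ hx two_ne_zero)]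
    simp
  have hTcont := hT.continuous
  calc ∫ x, ψ k (‖x‖ ^ 2) * divergence T x
      = ∫ x, -deriv (ψ k) (‖x‖ ^ 2) * (2 * inner ℝ x (T x)) := by
        rw [integral_mul_divergence hφ hT hTc, ← integral_neg]
        simp_rw [hφ', neg_mul]
    _ ≤ ∫ x, -deriv (ψ k) (‖x‖ ^ 2) * (2 * ‖M x‖) := by
        refine integral_mono (Continuous.integrable_of_hasCompactSupport (by fun_prop) ?_)
          (Continuous.integrable_of_hasCompactSupport (by fun_prop) hcs) fun x => ?_
        · refine hTc.mono fun x hx => ?_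
          contrapose hx
          rw [Function.notMem_support] at hx ⊢
          simp [hx]
        · exact mul_le_mul_of_nonneg_left (by linarith [hM x]) (hnn _)
    _ ≤ _ := integral_radial_mul_norm_le (hψ k) (hanti k) (hψ0 k) (hψ1 k) M

end Divergence

/-! ### Affine images of the unit ball and changes of variables. -/

section Ellipsoid

variable {E : Type*} [NormedAddCommGroup E] [InnerProductSpace ℝ E]

/-- The affine map `x ↦ x₀ + R D x`. -/
def affineHomeo (x₀ : E) {R : ℝ} (hR : R ≠ 0) (D : E ≃L[ℝ] E) : E ≃ₜ E :=
  (D.toHomeomorph.trans (Homeomorph.smulOfNeZero R hR)).trans (Homeomorph.addLeft x₀)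

theorem affineHomeo_apply (x₀ : E) {R : ℝ} (hR : R ≠ 0) (D : E ≃L[ℝ] E) (x : E) :
    affineHomeo x₀ hR D x = x₀ + R • D x := rfl

theorem affineHomeo_sub (x₀ : E) {R : ℝ} (hR : R ≠ 0) (D : E ≃L[ℝ] E) (x y : E) :
    affineHomeo x₀ hR D x - affineHomeo x₀ hR D y = R • D (x - y) := by
  rw [affineHomeo_apply, affineHomeo_apply, add_sub_add_left_eq_sub, ← smul_sub, map_sub]

theorem hasFDerivAt_affineHomeo (x₀ : E) {R : ℝ} (hR : R ≠ 0) (D : E ≃L[ℝ] E) (x : E) :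
    HasFDerivAt (affineHomeo x₀ hR D) (R • (D : E →L[ℝ] E)) x :=
  ((D : E →L[ℝ] E).hasFDerivAt.const_smul R).const_add x₀

theorem affineHomeo_refl_image_ball (x₀ : E) {R : ℝ} (hR : 0 < R) :
    affineHomeo x₀ hR.ne' (ContinuousLinearEquiv.refl ℝ E) '' ball 0 1 = ball x₀ R := by
  ext y
  constructor
  · rintro ⟨x, hx, rfl⟩
    rw [mem_ball_zero_iff] at hx
    rw [mem_ball_iff_norm, affineHomeo_apply, add_sub_cancel_left, norm_smul,
      Real.norm_of_nonneg hR.le]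
    exact mul_lt_of_lt_one_right hR hx
  · intro hy
    rw [mem_ball_iff_norm] at hy
    refine ⟨R⁻¹ • (y - x₀), ?_, ?_⟩
    · rw [mem_ball_zero_iff, norm_smul, norm_inv, Real.norm_of_nonneg hR.le, inv_mul_lt_one₀ hR]
      exact hy
    · simp [affineHomeo_apply, hR.ne']

theorem abs_det_smul_eq {R : ℝ} (hR : 0 < R) {D : E ≃L[ℝ] E}
    (hD : |(D : E →L[ℝ] E).det| = 1) :
    |(R • (D : E →L[ℝ] E)).det| = R ^ Module.finrank ℝ E := by
  have h : (R • (D : E →L[ℝ] E)).det = R ^ Module.finrank ℝ E * (D : E →L[ℝ] E).det :=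
    LinearMap.det_smul _ _
  rw [h, abs_mul, hD, mul_one, abs_of_pos (by positivity)]

variable [FiniteDimensional ℝ E] [MeasurableSpace E] [BorelSpace E]

theorem measurePreserving_of_abs_det_eq_one {D : E ≃L[ℝ] E}
    (hD : |(D : E →L[ℝ] E).det| = 1) : MeasurePreserving D volume volume := by
  refine ⟨D.continuous.measurable, ?_⟩
  have hD' : |LinearMap.det (D : E →L[ℝ] E).toLinearMap| = 1 := hD
  have h := Measure.map_linearMap_addHaar_eq_smul_addHaar (volume : Measure E)
    (f := (D : E →L[ℝ] E).toLinearMap) (by rw [← abs_ne_zero, hD']; exact one_ne_zero)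
  rw [abs_inv, hD', inv_one, ENNReal.ofReal_one, one_smul] at h
  exact h

theorem setLIntegral_affineHomeo_image (x₀ : E) {R : ℝ} (hR : 0 < R) {D : E ≃L[ℝ] E}
    (hD : |(D : E →L[ℝ] E).det| = 1) {s : Set E} (hs : MeasurableSet s) (g : E → ℝ≥0∞) :
    ∫⁻ x in affineHomeo x₀ hR.ne' D '' s, g x =
      ENNReal.ofReal (R ^ Module.finrank ℝ E) * ∫⁻ x in s, g (affineHomeo x₀ hR.ne' D x) := by
  rw [lintegral_image_eq_lintegral_abs_det_fderiv_mul volume hs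
    (fun x _ => (hasFDerivAt_affineHomeo x₀ hR.ne' D x).hasFDerivWithinAt)
    (affineHomeo x₀ hR.ne' D).injective.injOn, abs_det_smul_eq hR hD,
    lintegral_const_mul' _ _ ENNReal.ofReal_ne_top]

theorem volume_affineHomeo_image (x₀ : E) {R : ℝ} (hR : 0 < R) {D : E ≃L[ℝ] E}
    (hD : |(D : E →L[ℝ] E).det| = 1) {s : Set E} (hs : MeasurableSet s) :
    volume (affineHomeo x₀ hR.ne' D '' s) =
      ENNReal.ofReal (R ^ Module.finrank ℝ E) * volume s := by
  simpa using setLIntegral_affineHomeo_image x₀ hR hD hs 1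

theorem setIntegral_affineHomeo_image (x₀ : E) {R : ℝ} (hR : 0 < R) {D : E ≃L[ℝ] E}
    (hD : |(D : E →L[ℝ] E).det| = 1) {s : Set E} (hs : MeasurableSet s) (g : E → ℝ) :
    ∫ x in affineHomeo x₀ hR.ne' D '' s, g x =
      R ^ Module.finrank ℝ E * ∫ x in s, g (affineHomeo x₀ hR.ne' D x) := by
  rw [integral_image_eq_integral_abs_det_fderiv_smul volume hs
    (fun x _ => (hasFDerivAt_affineHomeo x₀ hR.ne' D x).hasFDerivWithinAt)
    (affineHomeo x₀ hR.ne' D).injective.injOn, abs_det_smul_eq hR hD]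
  simp_rw [smul_eq_mul]
  rw [integral_const_mul]

end Ellipsoid

/-! ### Perimeters of ellipsoids and balls. -/

section Perimeters

variable {N : ℕ}

theorem ofReal_integral_divergence_le_perimeter (A : Set (EuclideanSpace ℝ (Fin N)))
    {T : EuclideanSpace ℝ (Fin N) → EuclideanSpace ℝ (Fin N)} (hT : ContDiff ℝ 1 T)
    (hTc : HasCompactSupport T) (hT1 : ∀ x, ‖T x‖ ≤ 1) :
    ENNReal.ofReal (∫ x in A, divergence T x) ≤ perimeter A :=
  le_iSup_of_le T (le_iSup_of_le hT (le_iSup_of_le hTc (le_iSup_of_le hT1 le_rfl)))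

/-- A smooth extension of a multiple of the normal field of a ball. -/
theorem exists_field_eq_smul_sub (x₀ : EuclideanSpace ℝ (Fin N)) {R η : ℝ} (hR : 0 < R)
    (hη : η ∈ Ioo (0 : ℝ) 1) :
    ∃ T : EuclideanSpace ℝ (Fin N) → EuclideanSpace ℝ (Fin N), ContDiff ℝ 1 T ∧
      HasCompactSupport T ∧ (∀ x, ‖T x‖ ≤ 1) ∧
      ∀ x ∈ ball x₀ R, T x = ((1 - η) / R) • (x - x₀) := by
  have hη1 : 0 < 1 - η := by linarith [hη.2]
  have hη2 : (1 - η) < 1 := by linarith [hη.1]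
  -- The factor 1 - η leaves room for the cutoff: (1-η)|x - x₀|/R stays below 1 up to the outer
  -- radius R/(1-η).
  obtain ⟨χ, hχ⟩ : ∃ χ : ContDiffBump x₀, χ.rIn = R ∧ χ.rOut = R / (1 - η) :=
    ⟨⟨R, R / (1 - η), hR, by
      rw [lt_div_iff₀ hη1]; exact mul_lt_of_lt_one_right hR hη2⟩, rfl, rfl⟩
  have h1 : ContDiff ℝ 1 χ := χ.contDiff
  refine ⟨fun x => ((1 - η) / R) • χ x • (x - x₀), by fun_prop, ?_, fun x => ?_, fun x hx => ?_⟩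
  · have : HasCompactSupport fun x => χ x • (x - x₀) := χ.hasCompactSupport.smul_right
    exact this.comp_left (g := fun y => ((1 - η) / R) • y) (smul_zero _)
  · by_cases hx : x ∈ ball x₀ (R / (1 - η))
    · rw [mem_ball_iff_norm, lt_div_iff₀ hη1] at hx
      rw [norm_smul, norm_smul, Real.norm_of_nonneg (by positivity),
        Real.norm_of_nonneg χ.nonneg]
      have h1 : χ x * ‖x - x₀‖ ≤ ‖x - x₀‖ := mul_le_of_le_one_left (norm_nonneg _) χ.le_one
      calc (1 - η) / R * (χ x * ‖x - x₀‖) ≤ (1 - η) / R * ‖x - x₀‖ := by gcongr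
        _ = ‖x - x₀‖ * (1 - η) / R := by ring
        _ ≤ 1 := (div_le_one hR).2 hx.le
    · change ‖((1 - η) / R) • χ x • (x - x₀)‖ ≤ 1
      have : χ x = 0 := by
        have h := χ.support_eq
        rw [← Function.notMem_support, h, hχ.2]
        exact hx
      rw [this, zero_smul, smul_zero, norm_zero]
      exact zero_le_one
  · have : χ x = 1 := χ.one_of_mem_closedBall (by rw [hχ.1]; exact ball_subset_closedBall hx)
    simp only [this, one_smul]

variable [Nontrivial (EuclideanSpace ℝ (Fin N))]

/-- The fractional perimeter of an ellipsoid. -/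
theorem exists_fracPerimeter_ellipsoid {α : ℝ} (hα : 0 < α) (hα1 : α < 1) :
    ∃ κ : ℝ, 0 < κ ∧ ∀ (x₀ : EuclideanSpace ℝ (Fin N)) (R : ℝ) (hR : 0 < R)
      (D : EuclideanSpace ℝ (Fin N) ≃L[ℝ] EuclideanSpace ℝ (Fin N)),
      |(D : EuclideanSpace ℝ (Fin N) →L[ℝ] EuclideanSpace ℝ (Fin N)).det| = 1 →
      fracPerimeter α (affineHomeo x₀ hR.ne' D '' ball 0 1) =
        ENNReal.ofReal (κ * R ^ ((N : ℝ) - α) *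
          ∫ ω : sphere (0 : EuclideanSpace ℝ (Fin N)) 1, 1 / ‖D ω‖ ^ ((N : ℝ) + α)
            ∂volume.toSphere) := by
  obtain ⟨κ, hκ, h⟩ := exists_lintegral_mul_ballDefect (E := EuclideanSpace ℝ (Fin N)) hα hα1
  refine ⟨κ, hκ, fun x₀ R hR D hD => ?_⟩
  specialize h D
  rw [finrank_euclideanSpace_fin, ← lintegral_ball_lintegral_compl_ball (by fun_prop)] at h
  simp only [ContinuousLinearEquiv.coe_coe] at h
  have hc : (affineHomeo x₀ hR.ne' D '' ball 0 1)ᶜ = affineHomeo x₀ hR.ne' D '' (ball 0 1)ᶜ :=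
    (image_compl_eq (affineHomeo x₀ hR.ne' D).bijective).symm
  have hk : ∀ x y, ENNReal.ofReal (1 / ‖affineHomeo x₀ hR.ne' D x - affineHomeo x₀ hR.ne' D y‖ ^
      ((N : ℝ) + α)) = ENNReal.ofReal (R ^ (-((N : ℝ) + α))) *
        ENNReal.ofReal (1 / ‖D (x - y)‖ ^ ((N : ℝ) + α)) := fun x y => by
    rw [affineHomeo_sub, norm_smul, Real.norm_of_nonneg hR.le, Real.mul_rpow hR.le (norm_nonneg _),
      ← ENNReal.ofReal_mul (by positivity), Real.rpow_neg hR.le]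
    congr 1
    rw [one_div, one_div, mul_inv]
  rw [fracPerimeter, setLIntegral_affineHomeo_image x₀ hR hD measurableSet_ball, hc]
  simp_rw [setLIntegral_affineHomeo_image x₀ hR hD measurableSet_ball.compl, hk]
  simp_rw [lintegral_const_mul' _ _ ENNReal.ofReal_ne_top]
  rw [h, finrank_euclideanSpace_fin, ← ofReal_integral_eq_lintegral_ofReal
    (integrable_sphere (continuous_one_div_norm_rpow D _))
    (Filter.Eventually.of_forall fun ω => by positivity)]
  rw [← ENNReal.ofReal_mul hκ.le, ← ENNReal.ofReal_mul (by positivity),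
    ← ENNReal.ofReal_mul (by positivity), ← ENNReal.ofReal_mul (by positivity)]
  congr 1
  -- One Jacobian R^N for each of the two variables, and the homogeneity of the kernel.
  have h1 : R ^ ((N : ℝ) - α) = R ^ N * (R ^ N * R ^ (-((N : ℝ) + α))) := by
    rw [← Real.rpow_natCast, ← Real.rpow_add hR, ← Real.rpow_add hR]
    congr 1
    ring
  rw [h1]
  ring

/-- A test field T on the ellipsoid is pulled back to S = R⁻¹ D⁻¹ T∘Φ. Its derivative is conjugate
to that of T, so the divergence is preserved, and the symmetry of D⁻¹ gives ⟨x, S x⟩ ≤ R⁻¹ |D⁻¹x|.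
The flux bound on the unit ball then applies. -/
theorem perimeter_ellipsoid_le (x₀ : EuclideanSpace ℝ (Fin N)) {R : ℝ} (hR : 0 < R)
    {D : EuclideanSpace ℝ (Fin N) ≃L[ℝ] EuclideanSpace ℝ (Fin N)}
    (hD : |(D : EuclideanSpace ℝ (Fin N) →L[ℝ] EuclideanSpace ℝ (Fin N)).det| = 1)
    (hsymm : ∀ x y, inner ℝ x (D.symm y) = inner ℝ (D.symm x) y) :
    perimeter (affineHomeo x₀ hR.ne' D '' ball 0 1) ≤
      ENNReal.ofReal (R ^ ((N : ℝ) - 1) *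
        ∫ ω : sphere (0 : EuclideanSpace ℝ (Fin N)) 1, ‖D.symm ω‖ ∂volume.toSphere) := by
  refine iSup_le fun T => iSup_le fun hT => iSup_le fun hTc => iSup_le fun hT1 =>
    ENNReal.ofReal_le_ofReal ?_
  set Φ := affineHomeo x₀ hR.ne' D with hΦ
  have hΦd : ContDiff ℝ 1 Φ := by
    change ContDiff ℝ 1 fun x => x₀ + R • D x
    fun_prop
  set S : EuclideanSpace ℝ (Fin N) → EuclideanSpace ℝ (Fin N) := fun x => R⁻¹ • D.symm (T (Φ x))
    with hS
  have hSd : ContDiff ℝ 1 S := by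
    have := hT.comp hΦd
    exact (D.symm.contDiff.comp this).const_smul R⁻¹
  have hSc : HasCompactSupport S :=
    (hTc.comp_homeomorph Φ).comp_left (g := fun x => R⁻¹ • D.symm x) (by simp)
  have hdiv : ∀ x, divergence S x = divergence T (Φ x) := fun x => by
    have h1 : HasFDerivAt S (R⁻¹ • ((D.symm : EuclideanSpace ℝ (Fin N) →L[ℝ]
        EuclideanSpace ℝ (Fin N)).comp ((fderiv ℝ T (Φ x)).comp
          (R • (D : EuclideanSpace ℝ (Fin N) →L[ℝ] EuclideanSpace ℝ (Fin N)))))) x :=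
      ((D.symm : EuclideanSpace ℝ (Fin N) →L[ℝ] EuclideanSpace ℝ (Fin N)).hasFDerivAt.comp x
        ((hT.differentiable one_ne_zero (Φ x)).hasFDerivAt.comp x
          (hasFDerivAt_affineHomeo x₀ hR.ne' D x))).const_smul R⁻¹
    rw [divergence_eq_trace, divergence_eq_trace, h1.fderiv,
      ← LinearMap.trace_conj' (fderiv ℝ T (Φ x)).toLinearMap D.symm.toLinearEquiv]
    congr 1
    ext1 y
    simp [LinearEquiv.conj_apply, smul_smul, hR.ne']
  have hM : ∀ x, inner ℝ x (S x) ≤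
      ‖(R⁻¹ • (D.symm : EuclideanSpace ℝ (Fin N) →L[ℝ] EuclideanSpace ℝ (Fin N))) x‖ := fun x => by
    have h1 : inner ℝ x (S x) = R⁻¹ * inner ℝ (D.symm x) (T (Φ x)) := by
      rw [hS, inner_smul_right, hsymm]
    rw [h1, _root_.smul_apply, norm_smul, norm_inv, Real.norm_of_nonneg hR.le]
    refine mul_le_mul_of_nonneg_left ?_ (by positivity)
    exact (real_inner_le_norm _ _).trans (mul_le_of_le_one_right (norm_nonneg _) (hT1 _))
  have h := setIntegral_ball_divergence_le hSd hSc _ hM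
  simp_rw [hdiv] at h
  rw [setIntegral_affineHomeo_image x₀ hR hD measurableSet_ball, finrank_euclideanSpace_fin]
  refine (mul_le_mul_of_nonneg_left h (by positivity)).trans (le_of_eq ?_)
  simp_rw [_root_.smul_apply, norm_smul, norm_inv, Real.norm_of_nonneg hR.le]
  rw [integral_const_mul, ← mul_assoc, Real.rpow_sub_one hR.ne', Real.rpow_natCast, div_eq_mul_inv]
  rfl

/-- Test with fields equal to (1-η)(x - x₀)/R on the ball, of constant divergence (1-η)N/R there,
and let η tend to 0. -/
theorem le_perimeter_ball (x₀ : EuclideanSpace ℝ (Fin N)) {R : ℝ} (hR : 0 < R) :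
    ENNReal.ofReal (R ^ ((N : ℝ) - 1) *
      (volume : Measure (EuclideanSpace ℝ (Fin N))).toSphere.real univ) ≤
        perimeter (ball x₀ R) := by
  obtain ⟨c, hc⟩ : ∃ c, c = R ^ ((N : ℝ) - 1) *
    (volume : Measure (EuclideanSpace ℝ (Fin N))).toSphere.real univ := ⟨_, rfl⟩
  rw [← hc]
  have hlim : Filter.Tendsto (fun η : ℝ => ENNReal.ofReal ((1 - η) * c)) (nhdsWithin 0 (Ioi 0))
      (nhds (ENNReal.ofReal ((1 - 0) * c))) :=
    ((ENNReal.continuous_ofReal.comp (by fun_prop)).tendsto 0).mono_left nhdsWithin_le_nhds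
  rw [sub_zero, one_mul] at hlim
  refine le_of_tendsto hlim ?_
  filter_upwards [Ioo_mem_nhdsGT (zero_lt_one (α := ℝ))] with η hη
  obtain ⟨T, hT, hTc, hT1, hTeq⟩ := exists_field_eq_smul_sub x₀ hR hη
  have hdiv : ∀ x ∈ ball x₀ R, divergence T x = (1 - η) / R * N := fun x hx => by
    have h1 : T =ᶠ[nhds x] fun x => ((1 - η) / R) • (x - x₀) := by
      filter_upwards [isOpen_ball.mem_nhds hx] with y hy using hTeq y hy
    have h2 : HasFDerivAt (fun x => ((1 - η) / R) • (x - x₀))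
        (((1 - η) / R) • ContinuousLinearMap.id ℝ (EuclideanSpace ℝ (Fin N))) x := by
      have h3 : HasFDerivAt (fun y => y - x₀)
        (ContinuousLinearMap.id ℝ (EuclideanSpace ℝ (Fin N))) x := (hasFDerivAt_id x).sub_const x₀
      exact h3.const_smul ((1 - η) / R)
    rw [divergence_eq_trace, h1.fderiv_eq, h2.fderiv]
    have : (((1 - η) / R) • ContinuousLinearMap.id ℝ (EuclideanSpace ℝ (Fin N))).toLinearMap =
      ((1 - η) / R) • LinearMap.id := rfl
    rw [this, map_smul, LinearMap.trace_id, finrank_euclideanSpace_fin, smul_eq_mul]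
  have hint : ∫ x in ball x₀ R, divergence T x = (1 - η) * c := by
    rw [setIntegral_congr_fun measurableSet_ball hdiv, setIntegral_const, hc,
      Measure.toSphere_real_apply_univ, finrank_euclideanSpace_fin, measureReal_def,
      Measure.addHaar_ball volume _ hR.le, finrank_euclideanSpace_fin, ENNReal.toReal_mul,
      ENNReal.toReal_ofReal (by positivity), measureReal_def, Real.rpow_sub_one hR.ne',
      Real.rpow_natCast, smul_eq_mul]
    ring
  rw [← hint]
  exact ofReal_integral_divergence_le_perimeter _ hT hTc hT1

end Perimeters

/-! ### The diagonal maps that deform the ball. -/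

section Stretch

variable {N : ℕ}

/-- The eigenvalues `e^ε, e^{-ε}, 1, …, 1`. -/
def stretchWeight (ε : ℝ) (i : Fin N) : ℝ :=
  if (i : ℕ) = 0 then Real.exp ε else if (i : ℕ) = 1 then Real.exp (-ε) else 1

theorem stretchWeight_neg_mul (ε : ℝ) (i : Fin N) :
    stretchWeight (-ε) i * stretchWeight ε i = 1 := by
  unfold stretchWeight
  split_ifs <;> simp [← Real.exp_add]

theorem abs_stretchWeight_sub_one_le (ε : ℝ) (i : Fin N) :
    |stretchWeight ε i - 1| ≤ Real.exp |ε| - 1 := by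
  have h : ∀ a : ℝ, |Real.exp a - 1| ≤ Real.exp |a| - 1 := fun a => by
    rcases le_total 0 a with ha | ha
    · rw [abs_of_nonneg ha, abs_of_nonneg (by linarith [Real.add_one_le_exp a])]
    · rw [abs_of_nonpos ha, abs_of_nonpos (by linarith [Real.exp_le_one_iff.2 ha])]
      have h1 : Real.exp a * Real.exp (-a) = 1 := by rw [← Real.exp_add]; simp
      -- The claim is e^a + e^{-a} ≥ 2.
      nlinarith [sq_nonneg (Real.exp (-a) - 1), Real.exp_pos a, Real.exp_pos (-a),
        sq_nonneg (Real.exp a - Real.exp (-a)), sq_nonneg (Real.exp a + Real.exp (-a) - 2)]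
  unfold stretchWeight
  split_ifs
  · exact h ε
  · simpa using h (-ε)
  · simp

theorem norm_toLp_mul_le {c : Fin N → ℝ} {C : ℝ} (hC : 0 ≤ C) (hc : ∀ i, |c i| ≤ C)
    (x : EuclideanSpace ℝ (Fin N)) : ‖WithLp.toLp 2 fun i => c i * x i‖ ≤ C * ‖x‖ := by
  rw [EuclideanSpace.norm_eq, EuclideanSpace.norm_eq, ← Real.sqrt_sq hC,
    ← Real.sqrt_mul (sq_nonneg C), Finset.mul_sum]
  refine Real.sqrt_le_sqrt (Finset.sum_le_sum fun i _ => ?_)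
  simp only [norm_mul, mul_pow, Real.norm_eq_abs]
  exact mul_le_mul_of_nonneg_right (pow_le_pow_left₀ (abs_nonneg _) (hc i) 2) (sq_nonneg _)

/-- The volume preserving diagonal map with eigenvalues `e^ε, e^{-ε}, 1, …, 1`. -/
def stretch (ε : ℝ) : EuclideanSpace ℝ (Fin N) ≃L[ℝ] EuclideanSpace ℝ (Fin N) :=
  LinearEquiv.toContinuousLinearEquiv
    { toFun := fun x => WithLp.toLp 2 fun i => stretchWeight ε i * x i
      map_add' := fun x y => by ext i; simp [mul_add]
      map_smul' := fun c x => by ext i; simp [mul_left_comm]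
      invFun := fun x => WithLp.toLp 2 fun i => stretchWeight (-ε) i * x i
      left_inv := fun x => by ext i; simp [← mul_assoc, stretchWeight_neg_mul]
      right_inv := fun x => by
        ext i
        have := stretchWeight_neg_mul (-ε) i
        rw [neg_neg] at this
        simp [← mul_assoc, this] }

theorem stretch_apply (ε : ℝ) (x : EuclideanSpace ℝ (Fin N)) :
    stretch ε x = WithLp.toLp 2 fun i => stretchWeight ε i * x i := rfl

theorem stretch_symm (ε : ℝ) :
    (stretch ε : EuclideanSpace ℝ (Fin N) ≃L[ℝ] _).symm = stretch (-ε) :=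
  ContinuousLinearEquiv.ext rfl

theorem inner_stretch_right (ε : ℝ) (x y : EuclideanSpace ℝ (Fin N)) :
    inner ℝ x (stretch ε y) = inner ℝ (stretch ε x) y := by
  simp only [PiLp.inner_apply, stretch_apply]
  refine Finset.sum_congr rfl fun i _ => ?_
  simp only [RCLike.inner_apply, conj_trivial]
  ring

theorem det_stretch (hN : 2 ≤ N) (ε : ℝ) :
    ((stretch ε : EuclideanSpace ℝ (Fin N) ≃L[ℝ] _) : EuclideanSpace ℝ (Fin N) →L[ℝ] _).det = 1 := by
  set b := (EuclideanSpace.basisFun (Fin N) ℝ).toBasis with hb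
  have h1 : ((stretch ε : EuclideanSpace ℝ (Fin N) ≃L[ℝ] EuclideanSpace ℝ (Fin N)) :
      EuclideanSpace ℝ (Fin N) →L[ℝ] EuclideanSpace ℝ (Fin N)).toLinearMap =
      Matrix.toLin b b (Matrix.diagonal (stretchWeight ε)) := by
    refine b.ext fun j => ?_
    rw [Matrix.toLin_self]
    ext i
    by_cases hij : i = j
    · subst hij; simp [hb, stretch_apply, Matrix.diagonal_apply, ite_smul]
    · simp [hb, stretch_apply, Matrix.diagonal_apply, ite_smul, hij]
  have h2 : ((stretch ε : EuclideanSpace ℝ (Fin N) ≃L[ℝ] EuclideanSpace ℝ (Fin N)) :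
      EuclideanSpace ℝ (Fin N) →L[ℝ] EuclideanSpace ℝ (Fin N)).det =
      ∏ i : Fin N, stretchWeight ε i := by
    rw [ContinuousLinearMap.det, h1, LinearMap.det_toLin, Matrix.det_diagonal]
  rw [h2]
  obtain ⟨n, rfl⟩ := Nat.exists_eq_add_of_le' hN
  rw [Fin.prod_univ_succ, Fin.prod_univ_succ]
  simp [stretchWeight, ← Real.exp_add]

theorem norm_stretch_sub_le (ε : ℝ) (x : EuclideanSpace ℝ (Fin N)) :
    ‖stretch ε x - x‖ ≤ (Real.exp |ε| - 1) * ‖x‖ := by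
  have h : stretch ε x - x = WithLp.toLp 2 fun i => (stretchWeight ε i - 1) * x i := by
    ext i
    simp [stretch_apply, sub_mul]
  rw [h]
  exact norm_toLp_mul_le (by linarith [Real.one_le_exp (abs_nonneg ε)])
    (abs_stretchWeight_sub_one_le ε) x

theorem norm_stretch_le (ε : ℝ) (x : EuclideanSpace ℝ (Fin N)) :
    ‖stretch ε x‖ ≤ Real.exp |ε| * ‖x‖ := by
  have h1 := norm_stretch_sub_le ε x
  have h2 := norm_le_norm_add_norm_sub x (stretch ε x)
  have h3 := norm_add_le (stretch ε x - x) x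
  rw [sub_add_cancel] at h3
  linarith

theorem le_norm_stretch (ε : ℝ) (x : EuclideanSpace ℝ (Fin N)) :
    Real.exp (-|ε|) * ‖x‖ ≤ ‖stretch ε x‖ := by
  have h := norm_stretch_le (-ε) (stretch ε x)
  rw [← stretch_symm, ContinuousLinearEquiv.symm_apply_apply, abs_neg] at h
  rw [Real.exp_neg, inv_mul_le_iff₀ (Real.exp_pos _)]
  exact h

theorem exists_norm_stretch_ne_one (hN : 2 ≤ N) {ε : ℝ} (hε : ε ≠ 0) :
    ∃ ω : sphere (0 : EuclideanSpace ℝ (Fin N)) 1, ‖stretch ε (ω : EuclideanSpace ℝ (Fin N))‖ ≠ 1 := by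
  set i : Fin N := ⟨0, by omega⟩
  refine ⟨⟨EuclideanSpace.single i 1, by simp⟩, ?_⟩
  have h : stretch ε (EuclideanSpace.single i 1) = EuclideanSpace.single i (Real.exp ε) := by
    ext j
    by_cases hj : j = i
    · subst hj; simp [stretch_apply, stretchWeight, i]
    · simp [stretch_apply, hj]
  simp [h, hε]

end Stretch

/-! ### Ellipsoids as C¹-small graphs over the sphere. -/

section Graph

variable {E : Type*} [NormedAddCommGroup E] [InnerProductSpace ℝ E]

theorem hasFDerivAt_norm_of_ne_zero {x : E} (hx : x ≠ 0) :
    HasFDerivAt (fun y : E => ‖y‖) (‖x‖⁻¹ • innerSL ℝ x) x := by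
  have h := (hasStrictFDerivAt_norm_sq x).hasFDerivAt.sqrt (by simpa using hx)
  have h1 : (fun y : E => √(‖y‖ ^ 2)) = fun y => ‖y‖ := by
    funext y
    exact Real.sqrt_sq (norm_nonneg y)
  rw [h1] at h
  refine h.congr_fderiv ?_
  ext v
  simp only [Real.sqrt_sq (norm_nonneg x), _root_.smul_apply, innerSL_apply_apply, smul_eq_mul,
    nsmul_eq_mul]
  field_simp
  simp

/-- The function is the 0-homogeneous extension of 1/|Ay| - 1. With a = |Ax|, its derivative at a
unit vector x in direction v is a⁻³ (a²⟨x,v⟩ - ⟨Ax,Av⟩), which vanishes for A = id and is estimated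
through A - id. The constant is 40 = 8 · 5: a⁻³ ≤ 8 as a ≥ 1/2, and 5 = 5/2 + 3/2 + 1 from the three
error terms. -/
theorem norm_fderiv_norm_div_norm_le {A : E ≃L[ℝ] E} {η : ℝ} (hη0 : 0 ≤ η) (hη : η ≤ 1 / 2)
    (hA : ∀ z, ‖A z - z‖ ≤ η * ‖z‖) {x : E} (hx : ‖x‖ = 1) :
    ‖fderiv ℝ (fun y => ‖y‖ * ‖A y‖⁻¹ - 1) x‖ ≤ 40 * η := by
  have hx0 : x ≠ 0 := by rintro rfl; simp at hx
  have hAx0 : A x ≠ 0 := by simpa using hx0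
  have ha0 : 0 < ‖A x‖ := norm_pos_iff.2 hAx0
  have hab : |‖A x‖ - 1| ≤ η := by
    have := abs_norm_sub_norm_le (A x) x
    rw [hx] at this
    exact this.trans ((hA x).trans (by rw [hx, mul_one]))
  obtain ⟨ha1, ha2⟩ := abs_le.1 hab
  have h1 : HasFDerivAt (fun y => ‖A y‖)
      ((‖A x‖⁻¹ • innerSL ℝ (A x)).comp (A : E →L[ℝ] E)) x :=
    (hasFDerivAt_norm_of_ne_zero hAx0).comp x (A : E →L[ℝ] E).hasFDerivAt
  have h2 := ((hasFDerivAt_norm_of_ne_zero hx0).mul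
    ((hasDerivAt_inv ha0.ne').comp_hasFDerivAt x h1)).sub_const 1
  have h3 : fderiv ℝ (fun y => ‖y‖ * ‖A y‖⁻¹ - 1) x = _ := h2.fderiv
  rw [h3]
  refine ContinuousLinearMap.opNorm_le_bound _ (by positivity) fun v => ?_
  set a := ‖A x‖ with ha
  have hval : a⁻¹ ^ 3 * (a ^ 2 * inner ℝ x v - inner ℝ (A x) (A v)) =
      (‖x‖ • (-(a ^ 2)⁻¹ • (a⁻¹ • innerSL ℝ (A x)).comp (A : E →L[ℝ] E)) +
        (Inv.inv ∘ fun y => ‖A y‖) x • ‖x‖⁻¹ • innerSL ℝ x) v := by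
    simp only [hx, ← ha, Function.comp_apply, _root_.smul_apply, _root_.add_apply, innerSL_apply_apply, smul_eq_mul,
      ContinuousLinearMap.comp_apply, ContinuousLinearEquiv.coe_coe]
    field_simp
    ring
  rw [← hval, norm_mul, Real.norm_eq_abs, Real.norm_eq_abs]
  have hAv : ‖A v‖ ≤ (1 + η) * ‖v‖ := by
    have h4 := norm_add_le (A v - v) v
    rw [sub_add_cancel] at h4
    linarith [hA v]
  have h5 : |a ^ 2 * inner ℝ x v - inner ℝ (A x) (A v)| ≤ 5 * η * ‖v‖ := by
    have e1 : a ^ 2 * inner ℝ x v - inner ℝ (A x) (A v) =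
        (a ^ 2 - 1) * inner ℝ x v - inner ℝ (A x - x) (A v) - inner ℝ x (A v - v) := by
      rw [inner_sub_left, inner_sub_right]
      ring
    have e2 : |(a ^ 2 - 1) * inner ℝ x v| ≤ 5 / 2 * η * ‖v‖ := by
      rw [abs_mul]
      have := abs_real_inner_le_norm x v
      rw [hx, one_mul] at this
      refine mul_le_mul ?_ this (abs_nonneg _) (by positivity)
      rw [abs_le]
      constructor <;> nlinarith
    have e3 : |inner ℝ (A x - x) (A v)| ≤ 3 / 2 * η * ‖v‖ := by
      have h6 := hA x
      rw [hx, mul_one] at h6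
      calc _ ≤ ‖A x - x‖ * ‖A v‖ := abs_real_inner_le_norm _ _
        _ ≤ η * ((1 + η) * ‖v‖) := mul_le_mul h6 hAv (norm_nonneg _) hη0
        _ ≤ η * (3 / 2 * ‖v‖) := by
          gcongr
          linarith
        _ = _ := by ring
    have e4 : |inner ℝ x (A v - v)| ≤ η * ‖v‖ := by
      have := abs_real_inner_le_norm x (A v - v)
      rw [hx, one_mul] at this
      exact this.trans (hA v)
    rw [e1]
    rw [abs_le] at *
    constructor <;> linarith [e2.1, e2.2, e3.1, e3.2, e4.1, e4.2]
  have h6 : |a⁻¹ ^ 3| ≤ 8 := by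
    have h7 : a⁻¹ ≤ 2 := by
      rw [inv_le_comm₀ ha0 two_pos]
      linarith
    rw [abs_of_pos (by positivity)]
    calc a⁻¹ ^ 3 ≤ 2 ^ 3 := by gcongr
      _ = 8 := by norm_num
  calc |a⁻¹ ^ 3| * |a ^ 2 * inner ℝ x v - inner ℝ (A x) (A v)|
      ≤ 8 * (5 * η * ‖v‖) := mul_le_mul h6 h5 (abs_nonneg _) (by norm_num)
    _ = 40 * η * ‖v‖ := by ring

theorem sphereC1Le_inv_norm_sub_one {N : ℕ}
    {A : EuclideanSpace ℝ (Fin N) ≃L[ℝ] EuclideanSpace ℝ (Fin N)} {η : ℝ} (hη0 : 0 ≤ η)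
    (hη : η ≤ 1 / 2) (hA : ∀ z, ‖A z - z‖ ≤ η * ‖z‖) :
    SphereC1Le (fun x => ‖A x‖⁻¹ - 1) (40 * η) := by
  have heq : (fun x => ‖A (‖x‖⁻¹ • x)‖⁻¹ - 1) = fun x => ‖x‖ * ‖A x‖⁻¹ - 1 := by
    funext x
    rw [map_smul, norm_smul, norm_inv, norm_norm, mul_inv, inv_inv]
  refine ⟨?_, fun x hx => ⟨?_, ?_⟩⟩
  · rw [heq]
    intro x hx
    have hx0 : x ≠ 0 := hx
    have hAx : A x ≠ 0 := by simpa using hx0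
    exact (((contDiffAt_norm ℝ hx0).mul (((A.contDiff.contDiffAt).norm ℝ hAx).inv
      (norm_ne_zero_iff.2 hAx))).sub contDiffAt_const).contDiffWithinAt
  · rw [mem_sphere_zero_iff_norm] at hx
    have hab : |‖A x‖ - 1| ≤ η := by
      have := abs_norm_sub_norm_le (A x) x
      rw [hx] at this
      exact this.trans ((hA x).trans (by rw [hx, mul_one]))
    obtain ⟨ha1, ha2⟩ := abs_le.1 hab
    have ha0 : 0 < ‖A x‖ := by linarith
    have h1 : ‖A x‖⁻¹ - 1 = (1 - ‖A x‖) / ‖A x‖ := by field_simp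
    change |‖A x‖⁻¹ - 1| ≤ _
    rw [h1, abs_div, abs_sub_comm, abs_of_pos ha0, div_le_iff₀ ha0]
    nlinarith
  · rw [heq]
    exact norm_fderiv_norm_div_norm_le hη0 hη hA (mem_sphere_zero_iff_norm.1 hx)

/-- In the direction x the boundary of the ellipsoid lies at distance R/|D⁻¹x| from the centre, so
the graph function is u = 1/|D⁻¹x| - 1. -/
theorem frontier_affineHomeo_image_ball (x₀ : E) {R : ℝ} (hR : R ≠ 0) (D : E ≃L[ℝ] E) :
    frontier (affineHomeo x₀ hR D '' ball 0 1) =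
      (fun x => x₀ + (R * (1 + (‖D.symm x‖⁻¹ - 1))) • x) '' sphere 0 1 := by
  rw [← Homeomorph.image_frontier, frontier_ball _ one_ne_zero]
  simp_rw [add_sub_cancel]
  ext y
  constructor
  · rintro ⟨x, hx, rfl⟩
    rw [mem_sphere_zero_iff_norm] at hx
    have hx0 : x ≠ 0 := by rintro rfl; simp at hx
    have hD : ‖D x‖ ≠ 0 := norm_ne_zero_iff.2 (by simpa using hx0)
    refine ⟨‖D x‖⁻¹ • D x, ?_, ?_⟩
    · rw [mem_sphere_zero_iff_norm, norm_smul, norm_inv, norm_norm, inv_mul_cancel₀ hD]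
    · simp only [map_smul, D.symm_apply_apply, norm_smul, norm_inv, norm_norm, hx, mul_one,
        inv_inv, smul_smul, affineHomeo_apply]
      rw [mul_assoc, mul_inv_cancel₀ hD, mul_one]
  · rintro ⟨x, hx, rfl⟩
    rw [mem_sphere_zero_iff_norm] at hx
    have hx0 : x ≠ 0 := by rintro rfl; simp at hx
    have hD : ‖D.symm x‖ ≠ 0 := norm_ne_zero_iff.2 (by simpa using hx0)
    refine ⟨‖D.symm x‖⁻¹ • D.symm x, ?_, ?_⟩
    · rw [mem_sphere_zero_iff_norm, norm_smul, norm_inv, norm_norm, inv_mul_cancel₀ hD]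
    · rw [affineHomeo_apply, map_smul, D.apply_symm_apply, smul_smul]

/-- Both sets contain the ball of radius R/c and are contained in that of radius cR. -/
theorem symmDiff_ball_affineHomeo_image_subset (x₀ : E) {R c : ℝ} (hR : 0 < R) (hc : 1 ≤ c)
    {D : E ≃L[ℝ] E} (hD : ∀ x, ‖D x‖ ≤ c * ‖x‖) (hD' : ∀ x, ‖D.symm x‖ ≤ c * ‖x‖) :
    symmDiff (ball x₀ R) (affineHomeo x₀ hR.ne' D '' ball 0 1) ⊆
      ball x₀ (c * R) \ ball x₀ (c⁻¹ * R) := by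
  have hc0 : 0 < c := by linarith
  have hci : c⁻¹ * R ≤ R := mul_le_of_le_one_left hR.le (inv_le_one_of_one_le₀ hc)
  have hcR : R ≤ c * R := le_mul_of_one_le_left hR.le hc
  have h1 : affineHomeo x₀ hR.ne' D '' ball 0 1 ⊆ ball x₀ (c * R) := by
    rintro _ ⟨x, hx, rfl⟩
    rw [mem_ball_zero_iff] at hx
    rw [mem_ball_iff_norm, affineHomeo_apply, add_sub_cancel_left, norm_smul,
      Real.norm_of_nonneg hR.le, mul_comm]
    refine mul_lt_mul_of_pos_right ((hD x).trans_lt ?_) hR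
    exact mul_lt_of_lt_one_right hc0 hx
  have h2 : ball x₀ (c⁻¹ * R) ⊆ affineHomeo x₀ hR.ne' D '' ball 0 1 := by
    intro y hy
    rw [mem_ball_iff_norm] at hy
    refine ⟨D.symm (R⁻¹ • (y - x₀)), ?_, ?_⟩
    · rw [mem_ball_zero_iff]
      refine (hD' _).trans_lt ?_
      rw [norm_smul, norm_inv, Real.norm_of_nonneg hR.le]
      calc c * (R⁻¹ * ‖y - x₀‖) < c * (R⁻¹ * (c⁻¹ * R)) := by gcongr
        _ = 1 := by field_simp
    · simp [affineHomeo_apply, hR.ne']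
  rintro y (⟨hy1, hy2⟩ | ⟨hy1, hy2⟩)
  · exact ⟨ball_subset_ball hcR hy1, fun h => hy2 (h2 h)⟩
  · exact ⟨h1 hy1, fun h => hy2 (ball_subset_ball hci h)⟩

end Graph

/-! ### Comparison of the energies of ellipsoid and ball. -/

section Energy

variable {N : ℕ}

theorem det_refl_eq_one : |((ContinuousLinearEquiv.refl ℝ (EuclideanSpace ℝ (Fin N)) :
    EuclideanSpace ℝ (Fin N) ≃L[ℝ] EuclideanSpace ℝ (Fin N)) :
      EuclideanSpace ℝ (Fin N) →L[ℝ] EuclideanSpace ℝ (Fin N)).det| = 1 := by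
  have h : ((ContinuousLinearEquiv.refl ℝ (EuclideanSpace ℝ (Fin N)) :
    EuclideanSpace ℝ (Fin N) ≃L[ℝ] EuclideanSpace ℝ (Fin N)) :
      EuclideanSpace ℝ (Fin N) →L[ℝ] EuclideanSpace ℝ (Fin N)).det = 1 := LinearMap.det_id
  rw [h, abs_one]

theorem energy_le_of_le {s t a b : ℝ} (ha : 0 ≤ a) (hb : 0 ≤ b)
    {A : Set (EuclideanSpace ℝ (Fin N))} (h1 : attractivePart t A ≤ ENNReal.ofReal a)
    (h2 : repulsivePart s A = ENNReal.ofReal b) : energy s t A ≤ ((a - b : ℝ) : EReal) := by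
  rw [energy, if_neg (ne_top_of_le_ne_top ENNReal.ofReal_ne_top h1), h2, EReal.coe_sub]
  refine EReal.sub_le_sub ?_ ?_
  · refine (EReal.coe_ennreal_le_coe_ennreal_iff.2 h1).trans_eq ?_
    rw [EReal.coe_ennreal_ofReal, max_eq_left ha]
  · rw [EReal.coe_ennreal_ofReal, max_eq_left hb]

theorem le_energy_of_le {s t a b : ℝ} (ha : 0 ≤ a) (hb : 0 ≤ b)
    {A : Set (EuclideanSpace ℝ (Fin N))} (h1 : ENNReal.ofReal a ≤ attractivePart t A)
    (h2 : repulsivePart s A = ENNReal.ofReal b) : ((a - b : ℝ) : EReal) ≤ energy s t A := by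
  rw [energy]
  split_ifs
  · exact le_top
  · rw [h2, EReal.coe_sub]
    refine EReal.sub_le_sub ?_ ?_
    · refine le_trans (le_of_eq ?_) (EReal.coe_ennreal_le_coe_ennreal_iff.2 h1)
      rw [EReal.coe_ennreal_ofReal, max_eq_left ha]
    · rw [EReal.coe_ennreal_ofReal, max_eq_left hb]

variable [Nontrivial (EuclideanSpace ℝ (Fin N))]

theorem exists_fracPerimeter_ellipsoid_ball {α : ℝ} (hα : 0 < α) (hα1 : α < 1) :
    ∃ κ : ℝ, 0 < κ ∧ ∀ (x₀ : EuclideanSpace ℝ (Fin N)) (R : ℝ) (hR : 0 < R)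
      (D : EuclideanSpace ℝ (Fin N) ≃L[ℝ] EuclideanSpace ℝ (Fin N)),
      |(D : EuclideanSpace ℝ (Fin N) →L[ℝ] EuclideanSpace ℝ (Fin N)).det| = 1 →
      fracPerimeter α (affineHomeo x₀ hR.ne' D '' ball 0 1) =
        ENNReal.ofReal (κ * R ^ ((N : ℝ) - α) *
          ∫ ω : sphere (0 : EuclideanSpace ℝ (Fin N)) 1, 1 / ‖D ω‖ ^ ((N : ℝ) + α)
            ∂volume.toSphere) ∧
      fracPerimeter α (ball x₀ R) = ENNReal.ofReal (κ * R ^ ((N : ℝ) - α) *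
        (volume : Measure (EuclideanSpace ℝ (Fin N))).toSphere.real univ) := by
  obtain ⟨κ, hκ, h⟩ := exists_fracPerimeter_ellipsoid (N := N) hα hα1
  refine ⟨κ, hκ, fun x₀ R hR D hD => ⟨h x₀ R hR D hD, ?_⟩⟩
  rw [← affineHomeo_refl_image_ball x₀ hR, h x₀ R hR _ det_refl_eq_one]
  simp [norm_eq_of_mem_sphere]

/-- This treats t < 1 and t = 1 alike, with one constant for all ellipsoids. One-sided bounds
suffice, since the ellipsoid is to have less energy than the ball. For t = 1 the constant is Nω_N,
the area of the unit sphere. -/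
theorem exists_attractivePart_ellipsoid_ball {t : ℝ} (ht : 0 < t) (ht1 : t ≤ 1) :
    ∃ A : ℝ, 0 < A ∧ ∀ (x₀ : EuclideanSpace ℝ (Fin N)) (R : ℝ) (hR : 0 < R)
      (D : EuclideanSpace ℝ (Fin N) ≃L[ℝ] EuclideanSpace ℝ (Fin N)),
      |(D : EuclideanSpace ℝ (Fin N) →L[ℝ] EuclideanSpace ℝ (Fin N)).det| = 1 →
      (∀ x y, inner ℝ x (D.symm y) = inner ℝ (D.symm x) y) →
      attractivePart t (affineHomeo x₀ hR.ne' D '' ball 0 1) ≤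
        ENNReal.ofReal (A * R ^ ((N : ℝ) - t) *
          ∫ ω : sphere (0 : EuclideanSpace ℝ (Fin N)) 1, 1 / ‖D ω‖ ^ ((N : ℝ) + t)
            ∂volume.toSphere) ∧
      ENNReal.ofReal (A * R ^ ((N : ℝ) - t) *
        (volume : Measure (EuclideanSpace ℝ (Fin N))).toSphere.real univ) ≤
          attractivePart t (ball x₀ R) := by
  rcases ht1.eq_or_lt with rfl | ht1
  · set A := (volume : Measure (EuclideanSpace ℝ (Fin N))).toSphere.real univ with hA
    have hA0 : 0 < A := ENNReal.toReal_pos (Measure.measure_univ_ne_zero.2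
      (Measure.toSphere_ne_zero _)) (measure_ne_top _ _)
    have hdim : dimOmega N = ENNReal.ofReal A := by
      rw [hA, measureReal_def, ENNReal.ofReal_toReal (measure_ne_top _ _),
        Measure.toSphere_apply_univ, finrank_euclideanSpace_fin, dimOmega]
    refine ⟨A, hA0, fun x₀ R hR D hD hsymm => ?_⟩
    simp only [attractivePart, if_true, hdim, mul_assoc A]
    rw [ENNReal.ofReal_mul hA0.le, ENNReal.ofReal_mul hA0.le]
    refine ⟨mul_le_mul_right ((perimeter_ellipsoid_le x₀ hR hD hsymm).trans_eq ?_) _,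
      mul_le_mul_right (le_perimeter_ball x₀ hR) _⟩
    rw [integral_norm_symm D (measurePreserving_of_abs_det_eq_one hD), finrank_euclideanSpace_fin]
  · obtain ⟨κ, hκ, h⟩ := exists_fracPerimeter_ellipsoid_ball (N := N) ht ht1
    refine ⟨(1 - t) * κ, mul_pos (by linarith) hκ, fun x₀ R hR D hD _ => ?_⟩
    simp only [attractivePart, if_neg ht1.ne, mul_assoc (1 - t)]
    rw [ENNReal.ofReal_mul (p := 1 - t) (by linarith), ENNReal.ofReal_mul (p := 1 - t) (by linarith),
      (h x₀ R hR D hD).1, (h x₀ R hR D hD).2]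
    exact ⟨le_rfl, le_rfl⟩

theorem exists_repulsivePart_ellipsoid_ball {s : ℝ} (hs : 0 < s) (hs1 : s < 1) :
    ∃ B : ℝ, 0 < B ∧ ∀ (x₀ : EuclideanSpace ℝ (Fin N)) (R : ℝ) (hR : 0 < R)
      (D : EuclideanSpace ℝ (Fin N) ≃L[ℝ] EuclideanSpace ℝ (Fin N)),
      |(D : EuclideanSpace ℝ (Fin N) →L[ℝ] EuclideanSpace ℝ (Fin N)).det| = 1 →
      repulsivePart s (affineHomeo x₀ hR.ne' D '' ball 0 1) =
        ENNReal.ofReal (B * R ^ ((N : ℝ) - s) *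
          ∫ ω : sphere (0 : EuclideanSpace ℝ (Fin N)) 1, 1 / ‖D ω‖ ^ ((N : ℝ) + s)
            ∂volume.toSphere) ∧
      repulsivePart s (ball x₀ R) = ENNReal.ofReal (B * R ^ ((N : ℝ) - s) *
        (volume : Measure (EuclideanSpace ℝ (Fin N))).toSphere.real univ) := by
  obtain ⟨κ, hκ, h⟩ := exists_fracPerimeter_ellipsoid_ball (N := N) hs hs1
  refine ⟨s * κ, mul_pos hs hκ, fun x₀ R hR D hD => ?_⟩
  simp only [repulsivePart, if_neg hs.ne', mul_assoc s]
  rw [ENNReal.ofReal_mul hs.le, ENNReal.ofReal_mul hs.le, (h x₀ R hR D hD).1, (h x₀ R hR D hD).2]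
  exact ⟨rfl, rfl⟩

/-- Beyond a certain radius every ellipsoid near the ball has less energy than the ball of the same
volume. -/
theorem exists_energy_ellipsoid_lt_energy_ball {s t : ℝ} (hs : 0 < s) (hst : s < t) (ht : t ≤ 1) :
    ∃ R₀ : ℝ, 0 < R₀ ∧ ∀ (x₀ : EuclideanSpace ℝ (Fin N)) (R : ℝ) (hR : 0 < R), R₀ < R →
      ∀ D : EuclideanSpace ℝ (Fin N) ≃L[ℝ] EuclideanSpace ℝ (Fin N),
      |(D : EuclideanSpace ℝ (Fin N) →L[ℝ] EuclideanSpace ℝ (Fin N)).det| = 1 →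
      (∀ x y, inner ℝ x (D.symm y) = inner ℝ (D.symm x) y) →
      (∀ ω : sphere (0 : EuclideanSpace ℝ (Fin N)) 1,
        1 / ‖D ω‖ ^ (N : ℝ) ∈ Icc (1 / 2 : ℝ) 2) →
      (∃ ω : sphere (0 : EuclideanSpace ℝ (Fin N)) 1, ‖D ω‖ ≠ 1) →
      energy s t (affineHomeo x₀ hR.ne' D '' ball 0 1) < energy s t (ball x₀ R) := by
  obtain ⟨A, hA, hatt⟩ := exists_attractivePart_ellipsoid_ball (N := N) (hs.trans hst) ht
  obtain ⟨B, hB, hrep⟩ := exists_repulsivePart_ellipsoid_ball (N := N) hs (hst.trans_le ht)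
  obtain ⟨K, hK, hJ⟩ := exists_integral_one_div_norm_rpow_sub_le
    (E := EuclideanSpace ℝ (Fin N)) hs t
  rw [finrank_euclideanSpace_fin] at hJ
  have hts : 0 < t - s := sub_pos.2 hst
  have hq : 0 < A * K / B := by positivity
  -- The radius at which A K R^{N-t} = B R^{N-s}. None of A, B, K depends on the ellipsoid.
  refine ⟨(A * K / B) ^ (1 / (t - s)), Real.rpow_pos_of_pos hq _,
    fun x₀ R hR hR₀ D hD hsymm hmem hne => ?_⟩
  obtain ⟨hpos, hle⟩ := hJ D (measurePreserving_of_abs_det_eq_one hD) hmem hne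
  obtain ⟨ha1, ha2⟩ := hatt x₀ R hR D hD hsymm
  obtain ⟨hr1, hr2⟩ := hrep x₀ R hR D hD
  have hn : ∀ p : ℝ, 0 ≤ ∫ ω : sphere (0 : EuclideanSpace ℝ (Fin N)) 1,
      1 / ‖D ω‖ ^ p ∂volume.toSphere := fun p => integral_nonneg fun ω => by positivity
  have hpow : A * K * R ^ ((N : ℝ) - t) < B * R ^ ((N : ℝ) - s) := by
    have h1 : A * K / B < R ^ (t - s) := by
      have := Real.rpow_lt_rpow (Real.rpow_nonneg hq.le _) hR₀ hts
      rwa [← Real.rpow_mul hq.le, one_div_mul_cancel hts.ne', Real.rpow_one] at this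
    rw [div_lt_iff₀ hB] at h1
    have h2 : R ^ ((N : ℝ) - s) = R ^ (t - s) * R ^ ((N : ℝ) - t) := by
      rw [← Real.rpow_add hR]
      congr 1
      ring
    have h3 : 0 < R ^ ((N : ℝ) - t) := Real.rpow_pos_of_pos hR _
    calc A * K * R ^ ((N : ℝ) - t) < R ^ (t - s) * B * R ^ ((N : ℝ) - t) :=
          mul_lt_mul_of_pos_right h1 h3
      _ = B * R ^ ((N : ℝ) - s) := by rw [h2]; ring
  have hat : 0 < A * R ^ ((N : ℝ) - t) := mul_pos hA (Real.rpow_pos_of_pos hR _)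
  have hbt : 0 < B * R ^ ((N : ℝ) - s) := mul_pos hB (Real.rpow_pos_of_pos hR _)
  refine (energy_le_of_le (mul_nonneg hat.le (hn _)) (mul_nonneg hbt.le (hn _)) ha1 hr1).trans_lt
    (lt_of_lt_of_le (EReal.coe_lt_coe_iff.2 ?_) (le_energy_of_le
      (mul_nonneg hat.le measureReal_nonneg) (mul_nonneg hbt.le measureReal_nonneg) ha2 hr2))
  -- The excess of the attractive part is at most A K R^{N-t} times J(s) - σ(S), which is less than
  -- B R^{N-s} times it, the excess of the repulsive part.
  have h4 := mul_le_mul_of_nonneg_left hle hat.le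
  have h5 := mul_lt_mul_of_pos_right hpow hpos
  linarith

end Energy

/-! ### Choice of the ellipsoid and conclusion. -/

/-- Arbitrarily near to a large ball there is an ellipsoid of the same volume and less energy. -/
theorem exists_near_ball_energy_lt {N : ℕ} (hN : 2 ≤ N) {s t : ℝ} (hs : 0 < s) (hst : s < t)
    (ht : t ≤ 1) :
    ∃ R₀ : ℝ, 0 < R₀ ∧ ∀ (x₀ : EuclideanSpace ℝ (Fin N)) (R : ℝ), R₀ < R → ∀ δ : ℝ, 0 < δ →
      ∃ (u : EuclideanSpace ℝ (Fin N) → ℝ) (A : Set (EuclideanSpace ℝ (Fin N))),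
        MeasurableSet A ∧ volume A = volume (ball x₀ R) ∧
        volume (symmDiff (ball x₀ R) A) < ENNReal.ofReal δ ∧ SphereC1Le u δ ∧
        frontier A = (fun x => x₀ + (R * (1 + u x)) • x) '' sphere 0 1 ∧
        energy s t A < energy s t (ball x₀ R) := by
  have : Nonempty (Fin N) := ⟨⟨0, by omega⟩⟩
  have : Nontrivial (EuclideanSpace ℝ (Fin N)) := inferInstance
  obtain ⟨R₀, hR₀, h⟩ := exists_energy_ellipsoid_lt_energy_ball (N := N) hs hst ht
  refine ⟨R₀, hR₀, fun x₀ R hR δ hδ => ?_⟩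
  have hR0 : 0 < R := hR₀.trans hR
  set V := (volume (ball (0 : EuclideanSpace ℝ (Fin N)) 1)).toReal with hV
  have hVfin : volume (ball (0 : EuclideanSpace ℝ (Fin N)) 1) ≠ ⊤ := measure_ball_lt_top.ne
  have hcont : ∀ {f : ℝ → ℝ} {c : ℝ}, Continuous f → f 0 < c →
      ∀ᶠ ε in nhdsWithin (0 : ℝ) (Ioi 0), f ε < c := fun hf h0 =>
    ((hf.tendsto 0).eventually_lt_const h0).filter_mono nhdsWithin_le_nhds
  -- Four smallness conditions on ε: `h1` bounds the C¹ norm of the graph function, `h2` is the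
  -- range in which that bound holds, `h3` keeps |Dω|^{-N} in [1/2, 2], and `h4` makes the shell
  -- containing the symmetric difference smaller than δ.
  have h1 : ∀ᶠ ε in nhdsWithin (0 : ℝ) (Ioi 0), 40 * (Real.exp ε - 1) < δ :=
    hcont (by fun_prop) (by simpa using hδ)
  have h2 : ∀ᶠ ε in nhdsWithin (0 : ℝ) (Ioi 0), Real.exp ε - 1 < 1 / 2 :=
    hcont (by fun_prop) (by simp)
  have h3 : ∀ᶠ ε in nhdsWithin (0 : ℝ) (Ioi 0), Real.exp ε ^ N < 2 :=
    hcont (by fun_prop) (by simp)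
  have h4 : ∀ᶠ ε in nhdsWithin (0 : ℝ) (Ioi 0),
      (Real.exp ε * R) ^ N * V - ((Real.exp ε)⁻¹ * R) ^ N * V < δ :=
    hcont (by simp_rw [← Real.exp_neg]; fun_prop) (by simpa using hδ)
  obtain ⟨ε, hε1, hε2, hε3, hε4, hε⟩ :=
    (h1.and (h2.and (h3.and (h4.and self_mem_nhdsWithin)))).exists
  have hε0 : 0 < ε := hε
  have hc1 : 1 ≤ Real.exp ε := Real.one_le_exp hε0.le
  set D : EuclideanSpace ℝ (Fin N) ≃L[ℝ] EuclideanSpace ℝ (Fin N) := stretch ε with hDdef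
  have hdet : |(D : EuclideanSpace ℝ (Fin N) →L[ℝ] EuclideanSpace ℝ (Fin N)).det| = 1 := by
    rw [hDdef, det_stretch hN, abs_one]
  have hDsymm : D.symm = stretch (-ε) := stretch_symm ε
  have hDle : ∀ x, ‖D x‖ ≤ Real.exp ε * ‖x‖ := fun x => by
    simpa [abs_of_pos hε0] using norm_stretch_le ε x
  have hDle' : ∀ x, ‖D.symm x‖ ≤ Real.exp ε * ‖x‖ := fun x => by
    rw [hDsymm]
    simpa [abs_of_pos hε0] using norm_stretch_le (-ε) x
  have hvol : volume (affineHomeo x₀ hR0.ne' D '' ball 0 1) = volume (ball x₀ R) := by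
    rw [volume_affineHomeo_image x₀ hR0 hdet measurableSet_ball, Measure.addHaar_ball _ _ hR0.le]
  refine ⟨fun x => ‖D.symm x‖⁻¹ - 1, affineHomeo x₀ hR0.ne' D '' ball 0 1,
    ((affineHomeo x₀ hR0.ne' D).isOpenMap _ isOpen_ball).measurableSet, hvol, ?_, ?_,
    frontier_affineHomeo_image_ball x₀ hR0.ne' D, h x₀ R hR0 hR D hdet (fun x y => ?_)
      (fun ω => ?_) (exists_norm_stretch_ne_one hN hε0.ne')⟩
  · refine (measure_mono (symmDiff_ball_affineHomeo_image_subset x₀ hR0 hc1 hDle hDle')).trans_lt ?_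
    have hsub : (Real.exp ε)⁻¹ * R ≤ Real.exp ε * R := by
      gcongr
      exact (inv_le_one_of_one_le₀ hc1).trans hc1
    rw [measure_sdiff (ball_subset_ball hsub) measurableSet_ball.nullMeasurableSet
      measure_ball_lt_top.ne, Measure.addHaar_ball volume x₀ (by positivity : 0 ≤ Real.exp ε * R),
      Measure.addHaar_ball volume x₀ (by positivity : 0 ≤ (Real.exp ε)⁻¹ * R), finrank_euclideanSpace_fin,
      ← ENNReal.ofReal_toReal hVfin, ← hV, ← ENNReal.ofReal_mul (by positivity),
      ← ENNReal.ofReal_mul (by positivity), ← ENNReal.ofReal_sub _ (by positivity)]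
    exact (ENNReal.ofReal_lt_ofReal_iff hδ).2 hε4
  · have hS := sphereC1Le_inv_norm_sub_one (A := D.symm) (η := Real.exp ε - 1) (by linarith)
      hε2.le fun z => by
        rw [hDsymm]
        simpa [abs_of_pos hε0] using norm_stretch_sub_le (-ε) z
    exact ⟨hS.1, fun x hx => ⟨(hS.2 x hx).1.trans hε1.le, (hS.2 x hx).2.trans hε1.le⟩⟩
  · rw [hDsymm]
    exact inner_stretch_right (-ε) x y
  · have hω := norm_eq_of_mem_sphere ω
    have hup := hDle ω
    have hlo : (Real.exp ε)⁻¹ ≤ ‖D ω‖ := by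
      have := le_norm_stretch ε (ω : EuclideanSpace ℝ (Fin N))
      rwa [hω, mul_one, abs_of_pos hε0, Real.exp_neg] at this
    rw [hω, mul_one] at hup
    have hlo0 : 0 < ‖D ω‖ := lt_of_lt_of_le (by positivity) hlo
    rw [Real.rpow_natCast, one_div, mem_Icc, one_div]
    constructor
    · exact inv_anti₀ (by positivity) ((pow_le_pow_left₀ hlo0.le hup N).trans hε3.le)
    · rw [inv_le_comm₀ (by positivity) two_pos]
      have := pow_le_pow_left₀ (by positivity) hlo N
      rw [inv_pow] at this
      exact (inv_anti₀ (by positivity) hε3.le).trans this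

theorem ballRadius_lt_of_lt {N : ℕ} (hN : N ≠ 0) {R₀ m : ℝ} (hR₀ : 0 < R₀)
    (hm : R₀ ^ N * (volume (ball (0 : EuclideanSpace ℝ (Fin N)) 1)).toReal < m) :
    R₀ < ballRadius N m := by
  have hNt : Nonempty (Fin N) := ⟨⟨0, Nat.pos_of_ne_zero hN⟩⟩
  have hV : 0 < (volume (ball (0 : EuclideanSpace ℝ (Fin N)) 1)).toReal :=
    ENNReal.toReal_pos (measure_ball_pos volume _ one_pos).ne' measure_ball_lt_top.ne
  rw [← lt_div_iff₀ hV] at hm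
  have h := Real.rpow_lt_rpow (by positivity) hm (z := 1 / (N : ℝ)) (by positivity)
  rwa [one_div, Real.pow_rpow_inv_natCast hR₀.le hN, ← one_div] at h

end

theorem mainTheorem4 (N : ℕ) (hN : 2 ≤ N) (s t : ℝ) (hs : 0 < s) (hst : s < t) (ht : t ≤ 1) :
    ∃ m₂ : ℝ, 0 < m₂ ∧
      (∀ m₁ : ℝ, BallsOnlyMinimizersBelow N s t m₁ → m₁ ≤ m₂) ∧
      ∀ m : ℝ, m₂ < m → ∀ x₀ : EuclideanSpace ℝ (Fin N),
        ¬ IsVolLocalMinimizer s t m (ballOfVolume x₀ m) ∧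
        ¬ BallIsC1LocalMinimizer s t m x₀ := by
  obtain ⟨R₀, hR₀, h⟩ := exists_near_ball_energy_lt hN hs hst ht
  have hN0 : N ≠ 0 := by omega
  have hNt : Nonempty (Fin N) := ⟨⟨0, by omega⟩⟩
  set V := (volume (ball (0 : EuclideanSpace ℝ (Fin N)) 1)).toReal with hVdef
  have hV : 0 < V :=
    ENNReal.toReal_pos (measure_ball_pos volume _ one_pos).ne' measure_ball_lt_top.ne
  have hm₂ : 0 < R₀ ^ N * V := by positivity
  have key : ∀ m : ℝ, R₀ ^ N * V < m → ∀ x₀ : EuclideanSpace ℝ (Fin N),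
      ¬ IsVolLocalMinimizer s t m (ballOfVolume x₀ m) ∧ ¬ BallIsC1LocalMinimizer s t m x₀ := by
    intro m hm x₀
    have hball := admissible_ballOfVolume hN0 (hm₂.trans hm) x₀
    have hR := ballRadius_lt_of_lt hN0 hR₀ hm
    constructor
    · rintro ⟨-, δ, hδ, hmin⟩
      obtain ⟨u, A, hA, hvol, hsd, -, -, hlt⟩ := h x₀ _ hR δ hδ
      exact (hmin A ⟨hA.nullMeasurableSet, hvol.trans hball.2⟩ hsd).not_gt hlt
    · rintro ⟨δ, hδ, hmin⟩
      obtain ⟨u, A, hA, hvol, -, hu, hfr, hlt⟩ := h x₀ _ hR δ hδ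
      exact (hmin u A hu ⟨hA.nullMeasurableSet, hvol.trans hball.2⟩ hfr).not_gt hlt
  refine ⟨R₀ ^ N * V, hm₂, fun m₁ hm₁ => ?_, key⟩
  by_contra! hlt
  -- At a volume strictly between the two thresholds the ball would be a global minimizer, hence a
  -- local one, against `key`.
  obtain ⟨m, hm, hm'⟩ := exists_between hlt
  have hmin := (hm₁ m (hm₂.trans hm) hm' (ballOfVolume 0 m)).2 ⟨0, Filter.EventuallyEq.rfl⟩
  exact (key m hm 0).1 ⟨hmin.1, 1, one_pos, fun A hA _ => hmin.2 A hA⟩
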